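/- Let $d\ge 1$, let $(\mathbf X_n)_{n\in\mathbb N}$ be random vectors in $\mathbb R^d$, let $K$ be a positive-definite symmetric real $d\times d$ matrix and let $(t_n)_{n\in\mathbb N}$ be real numbers with $t_n\to+\infty$. Put $$\theta_n(\boldsymbol\zeta)=\mathbb E\big[e^{i\langle\boldsymbol\zeta,\mathbf X_n\rangle}\big]\,\exp\!\Big(t_n\,\tfrac{\boldsymbol\zeta^tK\boldsymbol\zeta}{2}\Big),\qquad \boldsymbol\zeta\in\mathbb R^d .$$ Suppose that $(\mathbf X_n)$ is mod-Gaussian convergent in the strong Fourier sense with parameters $t_nK$ and limit $\theta:\mathbb R^d\to\mathbb C$: the functions $\theta_n$ and $\theta$ are of class $C^{d+1}$ and, for every multi-index $\boldsymbol\alpha$ with $|\boldsymbol\alpha|\le d+1$, $\partial^{\boldsymbol\alpha}\theta_n\to\partial^{\boldsymbol\alpha}\theta$ locally uniformly on $\mathbb R^d$. Let $\mu_n$ be the law of $\mathbf X_n/\sqrt{t_n}$, let $\nu=\mathcal N_{\mathbb R^d}(\mathbf 0,K)$, and let $d_{\mathrm{convex}}(\mu,\nu)=\sup_C|\mu(C)-\nu(C)|$,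 the supremum being over all convex Borel subsets $C$ of $\mathbb R^d$. Then, as $n\to\infty$, $$d_{\mathrm{convex}}(\mu_n,\nu)=O\!\left(\frac1{\sqrt{t_n}}\right).$$ Moreover, let $d\ge2$ and write $\rho(A)$ for the spectral norm (Euclidean operator norm) of a matrix $A$, $\tau(K)=\rho(K)\,\rho(K^{-1})$ and, for $B>0$, $$M(B)=\sup_{n\in\mathbb N}\ \max_{|\boldsymbol\alpha|\le d+1}\ \max_{\boldsymbol\zeta\in[-B(2d+2)^{3/2},\,B(2d+2)^{3/2}]^d}\big|\partial^{\boldsymbol\alpha}\theta_n(\boldsymbol\zeta)\big| .$$ Then, for every $B>0$, $M(B)$ is finite and, for all $n$ large enough, $$d_{\mathrm{convex}}(\mu_n,\nu)\le\frac{2\,\rho(K^{-1/2})}{1-\frac4{9\pi}}\left(\Big(\frac{2\pi}{e}\Big)^{\frac d2}(d+1)^{\frac{3d}2+\frac{13}4}\,\tau(K)^{\frac d2+1}\,M(B)+2\sqrt{(d+1)\,\tau(K)}\;\frac1B\right)\frac1{\sqrt{t_n}} .$$ -/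

import Mathlib

open MeasureTheory ProbabilityTheory Filter Topology Asymptotics
open scoped ENNReal MatrixOrder

noncomputable section

/-- The convex distance between two (probability) measures on `ℝᵈ`: the supremum of
`|μ(C) - ν(C)|` over all convex Borel sets `C`. -/
def convexDist {d : ℕ} (μ ν : Measure (EuclideanSpace ℝ (Fin d))) : ℝ :=
  ⨆ C : {C : Set (EuclideanSpace ℝ (Fin d)) // Convex ℝ C ∧ MeasurableSet C},
    |μ.real C.1 - ν.real C.1|

/-- The residue `ζ ↦ E[exp(i⟨ζ, X⟩)] * exp(t ζᵗKζ / 2)` of a random vector `X` with law `μ`. -/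
def residue {d : ℕ} (K : Matrix (Fin d) (Fin d) ℝ) (t : ℝ)
    (μ : Measure (EuclideanSpace ℝ (Fin d))) (ζ : EuclideanSpace ℝ (Fin d)) : ℂ :=
  charFun μ ζ * Complex.exp ((t * (ζ.ofLp ⬝ᵥ K.mulVec ζ.ofLp) / 2 : ℝ) : ℂ)

/-- The partial derivative `∂ᵏf / ∂ζ_{i₁} ⋯ ∂ζ_{iₖ}` of order `k` of a function `f` on `ℝᵈ`
(for `f` of class `Cᵏ`; the order of the indices is then irrelevant). -/
def partialDeriv {d k : ℕ} (i : Fin k → Fin d) (f : EuclideanSpace ℝ (Fin d) → ℂ)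
    (ζ : EuclideanSpace ℝ (Fin d)) : ℂ :=
  iteratedFDeriv ℝ k f ζ (fun j => EuclideanSpace.single (i j) (1 : ℝ))

/-- A sequence of random vectors in `ℝᵈ` with laws `μ n` is mod-Gaussian convergent in the strong
Fourier sense, with parameters `t n • K` and limiting function `θ`: `t n → +∞`, and the residues,
together with all their partial derivatives up to order `d + 1`, converge locally uniformly
on `ℝᵈ` to `θ` and its partial derivatives. -/
structure StrongModGaussian {d : ℕ} (K : Matrix (Fin d) (Fin d) ℝ) (t : ℕ → ℝ)
    (μ : ℕ → Measure (EuclideanSpace ℝ (Fin d))) (θ : EuclideanSpace ℝ (Fin d) → ℂ) : Prop where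
  tendsto_atTop : Tendsto t atTop atTop
  contDiff_residue : ∀ n, ContDiff ℝ ((d + 1 : ℕ) : ℕ∞) (residue K (t n) (μ n))
  contDiff_limit : ContDiff ℝ ((d + 1 : ℕ) : ℕ∞) θ
  tendsto_partialDeriv : ∀ k ≤ d + 1, ∀ i : Fin k → Fin d,
    TendstoLocallyUniformly (fun n => partialDeriv i (residue K (t n) (μ n)))
      (partialDeriv i θ) atTop

/-- `M(B)`: the supremum of `|∂^α θₙ(ζ)|` over all `n`, all partial derivatives of order `≤ d + 1`,
and all `ζ` in the cube `[-B(2d+2)^{3/2}, B(2d+2)^{3/2}]ᵈ`. -/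
def residueSup {d : ℕ} (K : Matrix (Fin d) (Fin d) ℝ) (t : ℕ → ℝ)
    (μ : ℕ → Measure (EuclideanSpace ℝ (Fin d))) (B : ℝ) : ℝ≥0∞ :=
  ⨆ (n : ℕ) (k : ℕ) (_ : k ≤ d + 1) (i : Fin k → Fin d) (ζ : EuclideanSpace ℝ (Fin d))
    (_ : ∀ j, |ζ j| ≤ B * (2 * d + 2 : ℝ) ^ (3 / 2 : ℝ)),
    ‖partialDeriv i (residue K (t n) (μ n)) ζ‖ₑ

/-- The spectral norm `ρ(A)` of a real square matrix, i.e. the operator norm for the Euclidean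
norm on `ℝᵈ`. -/
def matSpectralNorm {d : ℕ} (A : Matrix (Fin d) (Fin d) ℝ) : ℝ :=
  ‖Matrix.toEuclideanCLM (𝕜 := ℝ) A‖

/-- `τ(K) = ρ(K) ρ(K⁻¹)`. -/
def conditionNumber {d : ℕ} (K : Matrix (Fin d) (Fin d) ℝ) : ℝ :=
  matSpectralNorm K * matSpectralNorm K⁻¹

/-- The explicit Berry–Esseen constant, where `K^{-1/2}` is the positive square root of `K⁻¹`. -/
def berryEsseenConst {d : ℕ} (K : Matrix (Fin d) (Fin d) ℝ) (M B : ℝ) : ℝ :=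
  2 * matSpectralNorm (CFC.sqrt K⁻¹) / (1 - 4 / (9 * Real.pi)) *
    ((2 * Real.pi / Real.exp 1) ^ ((d : ℝ) / 2) *
        ((d : ℝ) + 1) ^ (3 * (d : ℝ) / 2 + 13 / 4 : ℝ) *
        conditionNumber K ^ ((d : ℝ) / 2 + 1) * M +
      2 * √(((d : ℝ) + 1) * conditionNumber K) * (1 / B))

end

open scoped FourierTransform

/-! Write $A=K^{-1/2}$. By Hermitian symmetry the differential of $\theta_n$ at $0$ is $i\langle
b_n,\cdot\rangle$ with $b_n$ real, and the derivative bounds at the origin give $\|b_n\|\le\sqrt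
d\,M(B)$. Applying $A$ to $\mathbf X_n/\sqrt{t_n}$ and subtracting $Ab_n/\sqrt{t_n}$ yields a law
with characteristic function $g_n(\xi/\sqrt{t_n})e^{-|\xi|^2/2}$, where $g_n-1$ vanishes to second
order at $0$ and is bounded in $C^{d+1}$ on compact sets, uniformly in $n$.

The centred law is at convex distance $o(1/\sqrt{t_n})$ from the standard Gaussian
(`eventually_convexDist_stdGaussian_le`). Both are convolved with a kernel of scale $s/\sqrt{t_n}$
whose characteristic function has compact support, so that only values of $g_n$ on a fixed ball
matter. The difference of the smoothed characteristic functions is then $O(1/t_n)$ in $W^{d+1,1}$,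
hence so is its Fourier transform in $L^1$, which bounds the difference of the measures on every
Borel set (`abs_measureReal_sub_le_of_charFun_sub`). Removing the smoothing costs the Gaussian mass
of a shell of width proportional to $s/\sqrt{t_n}$ around a convex boundary
(`convexDist_le_of_conv`, `stdGaussian_boundaryShell_le`), and $s$ may be chosen arbitrarily small.

Undoing the centring translates convex sets by $Ab_n/\sqrt{t_n}$; the shell estimate bounds this by
$4d^2\rho(K^{-1/2})M(B)/\sqrt{t_n}$. This is the only contribution of order $1/\sqrt{t_n}$ that
cannot be made small, and it lies well below the stated constant (`le_berryEsseenConst`). -/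

/-! ### Gaussian measure of shells around convex boundaries. -/

/-- The points which are `ε`-close both to `C` and to its complement. -/
def boundaryShell {E : Type*} [PseudoMetricSpace E] (ε : ℝ) (C : Set E) : Set E :=
  {x | (∃ y ∈ C, dist x y ≤ ε) ∧ ∃ z ∉ C, dist x z ≤ ε}

/-- If `C` has interior points this is Hahn–Banach. Otherwise `C` lies in a proper affine subspace,
and a normal to it is constant on `C`, so one of its two signs works. The point `z` may be anywhere
outside `C`, boundary included. -/
theorem Convex.exists_supporting_unit {E : Type*} [NormedAddCommGroup E] [InnerProductSpace ℝ E]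
    [FiniteDimensional ℝ E] {C : Set E} (hC : Convex ℝ C) (hne : C.Nonempty) {z : E} (hz : z ∉ C) :
    ∃ n : E, ‖n‖ = 1 ∧ ∀ a ∈ C, inner ℝ n a ≤ inner ℝ n z := by
  suffices h : ∃ n : E, n ≠ 0 ∧ ∀ a ∈ C, inner ℝ n a ≤ inner ℝ n z by
    obtain ⟨n, hn, h⟩ := h
    have hpos : 0 < ‖n‖ := norm_pos_iff.2 hn
    refine ⟨‖n‖⁻¹ • n, by rw [norm_smul, norm_inv, norm_norm, inv_mul_cancel₀ hpos.ne'], ?_⟩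
    intro a ha
    rw [real_inner_smul_left, real_inner_smul_left]
    exact mul_le_mul_of_nonneg_left (h a ha) (by positivity)
  by_cases hint : (interior C).Nonempty
  · obtain ⟨f, hf, h⟩ := geometric_hahn_banach_of_nonempty_interior_point hC
      (fun h => hz (interior_subset h)) hint
    refine ⟨(InnerProductSpace.toDual ℝ E).symm f, by simpa using hf, ?_⟩
    simpa using h
  · obtain ⟨c, hc⟩ := hne
    have hspan : affineSpan ℝ C ≠ ⊤ := by rwa [Ne, ← hC.interior_nonempty_iff_affineSpan_eq_top]
    have hdir : (affineSpan ℝ C).direction ≠ ⊤ := by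
      intro h
      exact hspan ((AffineSubspace.direction_eq_top_iff_of_nonempty
        ⟨c, subset_affineSpan ℝ C hc⟩).1 h)
    obtain ⟨n, hn, hn0⟩ : ∃ n ∈ (affineSpan ℝ C).directionᗮ, n ≠ 0 := by
      apply Submodule.exists_mem_ne_zero_of_ne_bot
      rwa [Ne, Submodule.orthogonal_eq_bot_iff]
    have hconst : ∀ a ∈ C, inner ℝ n a = inner ℝ n c := by
      intro a ha
      have := (Submodule.mem_orthogonal' _ _).1 hn (a - c)
        (AffineSubspace.vsub_mem_direction (subset_affineSpan ℝ C ha) (subset_affineSpan ℝ C hc))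
      rw [inner_sub_right] at this
      linarith
    rcases le_total (inner ℝ n c) (inner ℝ n z) with h | h
    · exact ⟨n, hn0, fun a ha => (hconst a ha).trans_le h⟩
    · refine ⟨-n, neg_ne_zero.2 hn0, fun a ha => ?_⟩
      rw [inner_neg_left, inner_neg_left, hconst a ha]
      linarith

theorem gaussianReal_le_volume : gaussianReal 0 1 ≤ (volume : Measure ℝ) := by
  rw [gaussianReal_of_var_ne_zero 0 one_ne_zero]
  refine (withDensity_mono (Filter.Eventually.of_forall fun x => ?_)).trans_eq withDensity_one
  rw [gaussianPDF]
  refine ENNReal.ofReal_le_one.2 ?_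
  rw [gaussianPDFReal]
  have h1 : (√(2 * Real.pi * (1 : NNReal)))⁻¹ ≤ 1 := by
    apply inv_le_one_of_one_le₀
    rw [Real.one_le_sqrt]
    have := Real.pi_gt_three
    push_cast
    linarith
  have h2 : Real.exp (-(x - 0) ^ 2 / (2 * (1 : NNReal))) ≤ 1 := by
    rw [Real.exp_le_one_iff]
    push_cast
    have := sq_nonneg (x - 0)
    linarith
  exact mul_le_one₀ h1 (Real.exp_nonneg _) h2

/-- The condition bounds the diameter of `A` by `δ`, and the Gaussian density is at most `1`. -/
theorem gaussianReal_le_of_forall_add_notMem {A : Set ℝ} {δ : ℝ}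
    (hA : ∀ x ∈ A, ∀ s, δ < s → x + s ∉ A) : gaussianReal 0 1 A ≤ ENNReal.ofReal δ := by
  refine (gaussianReal_le_volume A).trans ?_
  refine (Real.volume_le_diam A).trans ?_
  refine Metric.ediam_le fun x hx y hy => ?_
  rw [edist_dist]
  refine ENNReal.ofReal_le_ofReal ?_
  rw [Real.dist_eq, abs_le]
  constructor
  · by_contra! h
    exact hA x hx (y - x) (by linarith) (by simpa using hy)
  · by_contra! h
    exact hA y hy (x - y) (by linarith) (by simpa using hx)

/-- Fubini: every line parallel to the `j`-th axis meets `A` in a set covered by the one-dimensional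
bound. -/
theorem stdGaussian_le_of_forall_add_notMem {d : ℕ} {A : Set (EuclideanSpace ℝ (Fin d))}
    (hAm : MeasurableSet A) (j : Fin d) {δ : ℝ}
    (hA : ∀ x ∈ A, ∀ s, δ < s → x + EuclideanSpace.single j s ∉ A) :
    stdGaussian (EuclideanSpace ℝ (Fin d)) A ≤ ENNReal.ofReal δ := by
  obtain ⟨n, rfl⟩ : ∃ n, d = n + 1 := ⟨d - 1, by have := j.pos; omega⟩
  rw [← map_pi_eq_stdGaussian, Measure.map_apply (by fun_prop) hAm]
  set A' := WithLp.toLp 2 ⁻¹' A with hA'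
  have hAm' : MeasurableSet A' := hAm.preimage (by fun_prop)
  have hmp := (measurePreserving_piFinSuccAbove (fun _ : Fin (n + 1) => gaussianReal 0 1) j).symm
  rw [← hmp.measure_preimage hAm'.nullMeasurableSet, Measure.prod_apply_symm
    (hAm'.preimage (MeasurableEquiv.measurable _))]
  calc _ ≤ ∫⁻ _ : Fin n → ℝ, ENNReal.ofReal δ ∂(Measure.pi fun _ => gaussianReal 0 1) := by
        refine lintegral_mono fun y => ?_
        refine gaussianReal_le_of_forall_add_notMem fun x hx s hs hx' => ?_
        refine hA _ hx s hs ?_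
        have : (WithLp.toLp 2 ((MeasurableEquiv.piFinSuccAbove (fun _ => ℝ) j).symm (x + s, y)) :
            EuclideanSpace ℝ (Fin (n + 1))) =
          WithLp.toLp 2 ((MeasurableEquiv.piFinSuccAbove (fun _ => ℝ) j).symm (x, y)) +
            EuclideanSpace.single j s := by
          ext i
          simp only [MeasurableEquiv.piFinSuccAbove_symm_apply, Fin.insertNthEquiv_apply,
            PiLp.add_apply]
          refine Fin.succAboveCases j ?_ (fun i => ?_) i <;> simp
        rw [← this]
        exact hx'
    _ = ENNReal.ofReal δ := by simp

/-- A unit normal supporting `C` at a nearby outside point has a coordinate of size at least `1/√d`.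
Moving along that signed axis therefore leaves `C` at speed at least `1/√d`, so the shell splits
into `2d` pieces, each thin along one axis. -/
theorem stdGaussian_boundaryShell_le {d : ℕ} {C : Set (EuclideanSpace ℝ (Fin d))}
    (hC : Convex ℝ C) {ε : ℝ} (hε : 0 ≤ ε) :
    stdGaussian (EuclideanSpace ℝ (Fin d)) (boundaryShell ε C) ≤
      ENNReal.ofReal (4 * (d * √d) * ε) := by
  rcases C.eq_empty_or_nonempty with rfl | hne
  · simp [boundaryShell]
  rcases Nat.eq_zero_or_pos d with rfl | hd
  · have : boundaryShell ε C = ∅ := by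
      ext x
      simp only [boundaryShell, Set.mem_ofPred_eq, Set.mem_empty_iff_false, iff_false]
      rintro ⟨⟨y, hy, -⟩, z, hz, -⟩
      exact hz (Subsingleton.elim y z ▸ hy)
    simp [this]
  have hd0 : (0 : ℝ) < √d := Real.sqrt_pos.2 (by exact_mod_cast hd)
  -- The Boolean is the sign of the escape direction. Stating the escape through `infDist` and
  -- non-strict inequalities makes each piece closed, hence measurable; the shell itself need not
  -- be.
  let A : Bool × Fin d → Set (EuclideanSpace ℝ (Fin d)) := fun p =>
    {x | Metric.infDist x C ≤ ε ∧ ∀ s : ℝ, 0 ≤ s →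
      s / √d - ε ≤ Metric.infDist (x + EuclideanSpace.single p.2 (if p.1 then s else -s)) C}
  have hclosed : ∀ p, IsClosed (A p) := by
    intro p
    have hp : A p = {x | Metric.infDist x C ≤ ε} ∩ ⋂ s : ℝ, ⋂ _ : 0 ≤ s, {x | s / √d - ε ≤
        Metric.infDist (x + EuclideanSpace.single p.2 (if p.1 then s else -s)) C} := by
      ext x
      simp [A]
    rw [hp]
    refine (isClosed_le (Metric.continuous_infDist_pt C) continuous_const).inter ?_
    refine isClosed_iInter fun s => isClosed_iInter fun _ => isClosed_le continuous_const ?_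
    exact (Metric.continuous_infDist_pt C).comp (by fun_prop)
  have hslice : ∀ p, stdGaussian (EuclideanSpace ℝ (Fin d)) (A p) ≤
      ENNReal.ofReal (2 * √d * ε) := by
    rintro ⟨b, j⟩
    -- Beyond this length the distance to `C` exceeds `2ε - ε = ε`, which contradicts the first
    -- condition in `A`.
    have key : ∀ x ∈ A (b, j), ∀ s, 2 * √d * ε < s →
        x + EuclideanSpace.single j (if b then s else -s) ∉ A (b, j) := by
      rintro x ⟨-, hx⟩ s hs ⟨hx', -⟩
      have h1 := hx s (le_trans (by positivity) hs.le)
      have h2 : 2 * ε < s / √d := by rw [lt_div_iff₀ hd0]; linarith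
      simp only at h1 hx'
      linarith
    refine stdGaussian_le_of_forall_add_notMem (hclosed _).measurableSet j fun x hx s hs hx' => ?_
    cases b
    · refine key _ hx' s hs ?_
      have : x + EuclideanSpace.single j s + EuclideanSpace.single j (if false = true then s else -s)
          = x := by
        ext i
        by_cases h : i = j <;> simp [h]
      rwa [this]
    · exact key x hx s hs (by simpa using hx')
  have hcover : boundaryShell ε C ⊆ ⋃ p, A p := by
    rintro x ⟨⟨y, hy, hxy⟩, z, hz, hxz⟩
    obtain ⟨n, hn1, hn⟩ := hC.exists_supporting_unit hne hz
    obtain ⟨j, hj⟩ : ∃ j, 1 / √d ≤ |n j| := by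
      by_contra! h
      have h1 : ‖n‖ ^ 2 = ∑ j, |n j| ^ 2 := by
        rw [EuclideanSpace.norm_sq_eq]
        simp
      have h2 : ∑ j, |n j| ^ 2 < ∑ j : Fin d, (1 / √d) ^ 2 := by
        refine Finset.sum_lt_sum_of_nonempty ⟨⟨0, hd⟩, Finset.mem_univ _⟩ fun j _ => ?_
        exact pow_lt_pow_left₀ (h j) (abs_nonneg _) two_ne_zero
      rw [← h1, hn1] at h2
      have hdd : (d : ℝ) ≠ 0 := by positivity
      simp [hdd] at h2
    refine Set.mem_iUnion.2 ⟨(decide (0 ≤ n j), j), (Metric.infDist_le_dist_of_mem hy).trans hxy, ?_⟩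
    intro s hs
    refine (Metric.le_infDist hne).2 fun a ha => ?_
    have h3 : inner ℝ n (EuclideanSpace.single j (if decide (0 ≤ n j) then s else -s))
        = |n j| * s := by
      rw [EuclideanSpace.inner_single_right]
      by_cases h : 0 ≤ n j
      · simp [h, abs_of_nonneg h, mul_comm]
      · simp [h, abs_of_neg (not_le.1 h), mul_comm]
    set x' := x + EuclideanSpace.single j (if decide (0 ≤ n j) then s else -s) with hx'
    have h4 : inner ℝ n (x' - a) ≤ dist x' a := by
      refine (real_inner_le_norm _ _).trans ?_
      rw [hn1, one_mul, dist_eq_norm]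
    have h5 : -ε ≤ inner ℝ n (x - z) := by
      have := (abs_le.1 (abs_real_inner_le_norm n (x - z))).1
      rw [hn1, one_mul, ← dist_eq_norm] at this
      linarith
    have h6 : s / √d ≤ |n j| * s := by
      have := mul_le_mul_of_nonneg_right hj hs
      rwa [one_div_mul_eq_div] at this
    rw [inner_sub_right, hx', inner_add_right, h3] at h4
    rw [inner_sub_right] at h5
    linarith [hn a ha]
  calc stdGaussian (EuclideanSpace ℝ (Fin d)) (boundaryShell ε C)
      ≤ stdGaussian (EuclideanSpace ℝ (Fin d)) (⋃ p, A p) := measure_mono hcover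
    _ ≤ ∑ p, stdGaussian (EuclideanSpace ℝ (Fin d)) (A p) := measure_iUnion_fintype_le _ _
    _ ≤ ∑ _p : Bool × Fin d, ENNReal.ofReal (2 * √d * ε) := Finset.sum_le_sum fun p _ => hslice p
    _ = ENNReal.ofReal (4 * (d * √d) * ε) := by
      rw [← ENNReal.ofReal_sum_of_nonneg (fun _ _ => by positivity)]
      congr 1
      simp
      ring

/-! ### Convex distance and removal of a smoothing kernel. -/

theorem abs_measureReal_sub_le_one {E : Type*} [MeasurableSpace E] (μ ν : Measure E)
    [IsProbabilityMeasure μ] [IsProbabilityMeasure ν] (C : Set E) :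
    |μ.real C - ν.real C| ≤ 1 := by
  rw [abs_le]
  have h1 : μ.real C ≤ 1 := measureReal_le_one
  have h2 : ν.real C ≤ 1 := measureReal_le_one
  have h3 : 0 ≤ μ.real C := measureReal_nonneg
  have h4 : 0 ≤ ν.real C := measureReal_nonneg
  constructor <;> linarith

theorem le_convexDist {d : ℕ} (μ ν : Measure (EuclideanSpace ℝ (Fin d)))
    [IsProbabilityMeasure μ] [IsProbabilityMeasure ν] {C : Set (EuclideanSpace ℝ (Fin d))}
    (hC : Convex ℝ C) (hCm : MeasurableSet C) : |μ.real C - ν.real C| ≤ convexDist μ ν :=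
  le_ciSup (f := fun C : {C : Set (EuclideanSpace ℝ (Fin d)) // Convex ℝ C ∧ MeasurableSet C} =>
    |μ.real C.1 - ν.real C.1|)
    ⟨1, by rintro _ ⟨C, rfl⟩; exact abs_measureReal_sub_le_one μ ν C.1⟩ ⟨C, hC, hCm⟩

theorem convexDist_le {d : ℕ} {μ ν : Measure (EuclideanSpace ℝ (Fin d))} {a : ℝ}
    (h : ∀ C : Set (EuclideanSpace ℝ (Fin d)), Convex ℝ C → MeasurableSet C →
      |μ.real C - ν.real C| ≤ a) : convexDist μ ν ≤ a := by
  have : Nonempty {C : Set (EuclideanSpace ℝ (Fin d)) // Convex ℝ C ∧ MeasurableSet C} :=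
    ⟨⟨∅, convex_empty, MeasurableSet.empty⟩⟩
  exact ciSup_le fun C => h C.1 C.2.1 C.2.2

theorem convexDist_nonneg {d : ℕ} (μ ν : Measure (EuclideanSpace ℝ (Fin d))) :
    0 ≤ convexDist μ ν :=
  Real.iSup_nonneg fun _ => abs_nonneg _

section Smoothing

variable {E : Type*} [NormedAddCommGroup E] [MeasurableSpace E] [BorelSpace E]
  [SecondCountableTopology E]

theorem measurable_measureReal_translate (μ : Measure E) [IsProbabilityMeasure μ] {D : Set E}
    (hD : MeasurableSet D) : Measurable fun y => μ.real {x | x + y ∈ D} := by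
  have h : MeasurableSet {p : E × E | p.2 + p.1 ∈ D} :=
    hD.preimage (f := fun p : E × E => p.2 + p.1) (by fun_prop)
  exact (measurable_measure_prodMk_left h).ennreal_toReal

theorem integrable_measureReal_translate (μ κ : Measure E) [IsProbabilityMeasure μ]
    [IsProbabilityMeasure κ] {D : Set E} (hD : MeasurableSet D) :
    Integrable (fun y => μ.real {x | x + y ∈ D}) κ :=
  (integrable_const (1 : ℝ)).mono' (measurable_measureReal_translate μ hD).aestronglyMeasurable
    (Eventually.of_forall fun y => by
      rw [Real.norm_eq_abs, abs_of_nonneg measureReal_nonneg]; exact measureReal_le_one)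

theorem measureReal_conv (μ κ : Measure E) [IsProbabilityMeasure μ] [IsProbabilityMeasure κ]
    {D : Set E} (hD : MeasurableSet D) :
    (μ.conv κ).real D = ∫ y, μ.real {x | x + y ∈ D} ∂κ := by
  have h : MeasurableSet ((fun p : E × E => p.1 + p.2) ⁻¹' D) := hD.preimage (by fun_prop)
  rw [integral_eq_lintegral_of_nonneg_ae (Eventually.of_forall fun y => measureReal_nonneg)
    (measurable_measureReal_translate μ hD).aestronglyMeasurable]
  rw [measureReal_def, Measure.conv, Measure.map_apply (by fun_prop) hD,
    Measure.prod_apply_symm h]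
  congr 1
  refine lintegral_congr fun y => ?_
  rw [ofReal_measureReal]
  rfl

omit [SecondCountableTopology E] in
-- With `p ≥ 3/4` the mass of the ball, the integral is at least `a p - b (1 - p)`; the case `a ≤ 0`
-- is immediate.
theorem le_of_conv_bounds (κ : Measure E) [IsProbabilityMeasure κ] {r a b T : ℝ} {F : E → ℝ}
    (hF : Integrable F κ) (hκ : 3 / 4 ≤ κ.real (Metric.closedBall 0 r)) (hb : 0 ≤ b)
    (hin : ∀ y, ‖y‖ ≤ r → a ≤ F y) (hout : ∀ y, -b ≤ F y) (hT : ∫ y, F y ∂κ ≤ T) (hT0 : 0 ≤ T) :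
    3 / 4 * a ≤ T + b / 4 := by
  rcases le_total a 0 with ha | ha
  · linarith
  set S := Metric.closedBall (0 : E) r
  have hS : MeasurableSet S := measurableSet_closedBall
  have h1 : a * κ.real S ≤ ∫ y in S, F y ∂κ := by
    rw [← smul_eq_mul, smul_eq_mul, mul_comm, ← smul_eq_mul, ← setIntegral_const]
    refine setIntegral_mono_on (integrable_const _).integrableOn hF.integrableOn hS fun y hy => ?_
    exact hin y (by simpa [S] using hy)
  have h2 : -b * κ.real Sᶜ ≤ ∫ y in Sᶜ, F y ∂κ := by
    rw [mul_comm, ← smul_eq_mul, ← setIntegral_const]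
    exact setIntegral_mono_on (integrable_const _).integrableOn hF.integrableOn hS.compl
      fun y _ => hout y
  have h3 := integral_add_compl hS hF
  have h4 : κ.real Sᶜ = 1 - κ.real S := by rw [measureReal_compl hS]; simp
  rw [h4] at h2
  nlinarith

end Smoothing

theorem measureReal_le_add_of_subset_union {E : Type*} [MeasurableSpace E] (ν : Measure E)
    [IsFiniteMeasure ν] {A B C : Set E} (h : A ⊆ B ∪ C) : ν.real A ≤ ν.real B + ν.real C :=
  (measureReal_mono h).trans (measureReal_union_le B C)

/-- For shifts `‖y‖ ≤ r` a fattened or eroded set is compared with `C` up to a shell. For the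
remaining shifts, of mass at most `1/4`, the crude bound is the convex distance itself, since
translates of convex sets are convex; it is then absorbed on the left. -/
theorem convexDist_le_of_conv {d : ℕ} (μ ν κ : Measure (EuclideanSpace ℝ (Fin d)))
    [IsProbabilityMeasure μ] [IsProbabilityMeasure ν] [IsProbabilityMeasure κ] {r S T : ℝ}
    (hr : 0 < r) (hκ : 3 / 4 ≤ κ.real (Metric.closedBall 0 r))
    (hS : ∀ C : Set (EuclideanSpace ℝ (Fin d)), Convex ℝ C → ν.real (boundaryShell (3 * r) C) ≤ S)
    (hT : ∀ D : Set (EuclideanSpace ℝ (Fin d)), MeasurableSet D →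
      |(μ.conv κ).real D - (ν.conv κ).real D| ≤ T) :
    convexDist μ ν ≤ 2 * T + 3 / 2 * S := by
  have hT0 : 0 ≤ T := (abs_nonneg _).trans (hT ∅ MeasurableSet.empty)
  set δ := convexDist μ ν with hδ
  have hδ0 : 0 ≤ δ := convexDist_nonneg μ ν
  have htr : ∀ (D : Set (EuclideanSpace ℝ (Fin d))), Convex ℝ D → MeasurableSet D → ∀ y,
      |μ.real {x | x + y ∈ D} - ν.real {x | x + y ∈ D}| ≤ δ := by
    intro D hD hDm y
    refine le_convexDist μ ν ?_ (hDm.preimage (f := fun x => x + y) (by fun_prop))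
    exact hD.translate_preimage_left y
  have key : ∀ C : Set (EuclideanSpace ℝ (Fin d)), Convex ℝ C → MeasurableSet C →
      |μ.real C - ν.real C| ≤ S + (T + δ / 4) / (3 / 4) := by
    intro C hC hCm
    have hSC := hS C hC
    rw [abs_le']
    constructor
    -- The radius `2r > r` gives `C ⊆ D - y` although the thickening is open; `D - y` exceeds `C`
    -- only within the `3r`-shell.
    · set D := Metric.thickening (2 * r) C with hD
      have hDc : Convex ℝ D := hC.thickening _
      have hDm : MeasurableSet D := Metric.isOpen_thickening.measurableSet
      have := le_of_conv_bounds κ (r := r) (a := μ.real C - ν.real C - S) (b := δ) (T := T)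
        (F := fun y => μ.real {x | x + y ∈ D} - ν.real {x | x + y ∈ D})
        ((integrable_measureReal_translate μ κ hDm).sub (integrable_measureReal_translate ν κ hDm))
        hκ hδ0 ?_ (fun y => (abs_le.1 (htr D hDc hDm y)).1) ?_ hT0
      · have h := (le_div_iff₀' (by norm_num : (0 : ℝ) < 3 / 4)).2 this
        linarith
      · intro y hy
        have h1 : μ.real C ≤ μ.real {x | x + y ∈ D} := by
          refine measureReal_mono fun x hx => ?_
          rw [Set.mem_ofPred_eq, hD, Metric.mem_thickening_iff]
          refine ⟨x, hx, ?_⟩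
          rw [dist_eq_norm, add_sub_cancel_left]
          linarith
        have h2 : ν.real {x | x + y ∈ D} ≤ ν.real C + ν.real (boundaryShell (3 * r) C) := by
          refine measureReal_le_add_of_subset_union ν fun x hx => ?_
          by_cases hxC : x ∈ C
          · exact Or.inl hxC
          · right
            rw [Set.mem_ofPred_eq, hD, Metric.mem_thickening_iff] at hx
            obtain ⟨z, hz, hxz⟩ := hx
            refine ⟨⟨z, hz, ?_⟩, x, hxC, by rw [dist_self]; linarith⟩
            have : dist x (x + y) ≤ r := by rwa [dist_comm, dist_eq_norm, add_sub_cancel_left]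
            linarith [dist_triangle x (x + y) z]
        linarith
      · rw [integral_sub (integrable_measureReal_translate μ κ hDm)
          (integrable_measureReal_translate ν κ hDm), ← measureReal_conv μ κ hDm,
          ← measureReal_conv ν κ hDm]
        exact (le_abs_self _).trans (hT D hDm)
    -- The erosion of `C` by an open ball: an intersection of translates of `C`, hence convex, and
    -- closed.
    · set D := (Metric.thickening (2 * r) Cᶜ)ᶜ with hD
      have hmem : ∀ x, x ∈ D ↔ ∀ v, ‖v‖ < 2 * r → x + v ∈ C := by
        intro x
        rw [hD, Set.mem_compl_iff, Metric.mem_thickening_iff]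
        constructor
        · intro h v hv
          by_contra hC'
          exact h ⟨x + v, hC', by simpa [dist_eq_norm] using hv⟩
        · rintro h ⟨z, hz, hxz⟩
          have := h (z - x) (by rwa [dist_comm, dist_eq_norm] at hxz)
          rw [add_sub_cancel] at this
          exact hz this
      have hDc : Convex ℝ D := by
        have : D = ⋂ v : EuclideanSpace ℝ (Fin d), ⋂ _ : ‖v‖ < 2 * r, (fun x => x + v) ⁻¹' C := by
          ext x
          simp [hmem]
        rw [this]
        exact convex_iInter fun v => convex_iInter fun _ => hC.translate_preimage_left v
      have hDm : MeasurableSet D := Metric.isOpen_thickening.measurableSet.compl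
      have := le_of_conv_bounds κ (r := r) (a := ν.real C - μ.real C - S) (b := δ) (T := T)
        (F := fun y => ν.real {x | x + y ∈ D} - μ.real {x | x + y ∈ D})
        ((integrable_measureReal_translate ν κ hDm).sub (integrable_measureReal_translate μ κ hDm))
        hκ hδ0 ?_ (fun y => by linarith [(abs_le.1 (htr D hDc hDm y)).2]) ?_ hT0
      · have h := (le_div_iff₀' (by norm_num : (0 : ℝ) < 3 / 4)).2 this
        linarith
      · intro y hy
        have h1 : μ.real {x | x + y ∈ D} ≤ μ.real C := by
          refine measureReal_mono fun x hx => ?_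
          rw [Set.mem_ofPred_eq, hmem] at hx
          have := hx (-y) (by rw [norm_neg]; linarith)
          rwa [add_neg_cancel_right] at this
        have h2 : ν.real C ≤ ν.real {x | x + y ∈ D} + ν.real (boundaryShell (3 * r) C) := by
          refine measureReal_le_add_of_subset_union ν fun x hx => ?_
          by_cases hxD : x + y ∈ D
          · exact Or.inl hxD
          · right
            rw [hmem] at hxD
            push Not at hxD
            obtain ⟨v, hv, hvC⟩ := hxD
            refine ⟨⟨x, hx, by rw [dist_self]; linarith⟩, _, hvC, ?_⟩
            rw [dist_comm, dist_eq_norm, add_assoc, add_sub_cancel_left]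
            linarith [norm_add_le y v]
        linarith
      · rw [integral_sub (integrable_measureReal_translate ν κ hDm)
          (integrable_measureReal_translate μ κ hDm), ← measureReal_conv μ κ hDm,
          ← measureReal_conv ν κ hDm]
        have := (abs_le.1 (hT D hDm)).1
        linarith
  -- This reads `δ ≤ S + 4T/3 + δ/3`, which is solved for `δ`.
  have := convexDist_le key
  rw [← hδ] at this
  linarith

/-! ### Fourier bounds and the smoothing kernel. -/

/-- The sum of the `L¹` norms of the derivatives of order at most `N`. -/
noncomputable def sobolevSum {d : ℕ} (N : ℕ) (f : EuclideanSpace ℝ (Fin d) → ℂ) : ℝ :=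
  ∑ j ∈ Finset.range (N + 1), ∫ v, ‖iteratedFDeriv ℝ j f v‖

/-- Derivatives of order `0` and `d + 1` in `L¹` make the transform decay like `(1 + ‖w‖)^{-(d+1)}`,
which is integrable in dimension `d`. -/
theorem exists_integral_norm_fourier_le (d : ℕ) : ∃ C : ℝ, 0 ≤ C ∧
    ∀ f : EuclideanSpace ℝ (Fin d) → ℂ, ContDiff ℝ ((d + 1 : ℕ) : ℕ∞) f →
      (∀ j ≤ d + 1, Integrable (iteratedFDeriv ℝ j f)) →
      Integrable (𝓕 f) ∧ ∫ w, ‖𝓕 f w‖ ≤ C * sobolevSum (d + 1) f := by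
  set I : ℝ := ∫ w : EuclideanSpace ℝ (Fin d), (1 + ‖w‖) ^ (-((d + 1 : ℕ) : ℝ)) with hI
  have hint : Integrable fun w : EuclideanSpace ℝ (Fin d) => (1 + ‖w‖) ^ (-((d + 1 : ℕ) : ℝ)) :=
    integrable_one_add_norm (by simp)
  have hI0 : 0 ≤ I := integral_nonneg fun w => by positivity
  refine ⟨2 ^ d * (1 + 2 ^ (d + 1)) * I, by positivity, fun f hf hfi => ?_⟩
  set J := sobolevSum (d + 1) f with hJ
  have hJ0 : 0 ≤ J := Finset.sum_nonneg fun j _ => integral_nonneg fun v => norm_nonneg _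
  have hb : ∀ n ≤ d + 1, ∀ w, ‖w‖ ^ n * ‖𝓕 f w‖ ≤ 2 ^ n * J := by
    intro n hn w
    have h := Real.pow_mul_norm_iteratedFDeriv_fourier_le (K := 0) (N := (d + 1 : ℕ)) hf
      (fun k m hk hm => ?_) (k := 0) (n := n) le_rfl (by exact_mod_cast hn) w
    · simp only [norm_iteratedFDeriv_zero, pow_zero, one_mul] at h
      refine h.trans ?_
      rw [Finset.sum_product]
      simp only [zero_add, Finset.range_one, Finset.sum_singleton, pow_zero, one_mul,
        CharP.cast_eq_zero, mul_zero]
      refine mul_le_mul_of_nonneg_left ?_ (by positivity)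
      refine Finset.sum_le_sum_of_subset_of_nonneg ?_ fun j _ _ =>
        integral_nonneg fun v => norm_nonneg _
      exact Finset.range_mono (by omega)
    · obtain rfl : k = 0 := by simpa using hk
      simpa using (hfi m (by exact_mod_cast hm)).norm
  have hpt : ∀ w, ‖𝓕 f w‖ ≤ 2 ^ d * (1 + 2 ^ (d + 1)) * J * (1 + ‖w‖) ^ (-((d + 1 : ℕ) : ℝ)) := by
    intro w
    rw [Real.rpow_neg (by positivity), Real.rpow_natCast, ← div_eq_mul_inv,
      le_div_iff₀ (by positivity)]
    have h0 := hb 0 (by omega) w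
    have h1 := hb (d + 1) le_rfl w
    have h2 := add_pow_le zero_le_one (norm_nonneg w) (d + 1)
    simp only [pow_zero, one_mul, one_pow, Nat.add_sub_cancel] at h0 h2
    calc ‖𝓕 f w‖ * (1 + ‖w‖) ^ (d + 1) ≤ ‖𝓕 f w‖ * (2 ^ d * (1 + ‖w‖ ^ (d + 1))) := by gcongr
      _ = 2 ^ d * (‖𝓕 f w‖ + ‖w‖ ^ (d + 1) * ‖𝓕 f w‖) := by ring
      _ ≤ 2 ^ d * (J + 2 ^ (d + 1) * J) := by gcongr
      _ = _ := by ring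
  have hcont : Continuous (𝓕 f) :=
    VectorFourier.fourierIntegral_continuous Real.continuous_fourierChar
      (by exact continuous_inner) (by
        have := hfi 0 (by omega)
        refine (integrable_norm_iff hf.continuous.aestronglyMeasurable).1 ?_
        simpa using this.norm)
  have hFi : Integrable (𝓕 f) :=
    (hint.const_mul _).mono' hcont.aestronglyMeasurable (Eventually.of_forall hpt)
  refine ⟨hFi, ?_⟩
  calc ∫ w, ‖𝓕 f w‖ ≤ ∫ w : EuclideanSpace ℝ (Fin d),
        2 ^ d * (1 + 2 ^ (d + 1)) * J * (1 + ‖w‖) ^ (-((d + 1 : ℕ) : ℝ)) :=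
        integral_mono hFi.norm (hint.const_mul _) hpt
    _ = _ := by rw [integral_const_mul]; ring

theorem conj_fourier_of_hermitian {E : Type*} [NormedAddCommGroup E] [InnerProductSpace ℝ E]
    [FiniteDimensional ℝ E] [MeasurableSpace E] [BorelSpace E] {f : E → ℂ}
    (hf : ∀ v, f (-v) = starRingEnd ℂ (f v)) (w : E) : starRingEnd ℂ (𝓕 f w) = 𝓕 f w := by
  rw [Real.fourier_eq', ← integral_conj, ← integral_neg_eq_self]
  congr 1
  ext v
  simp only [smul_eq_mul, map_mul, ← hf, neg_neg, ← Complex.exp_conj, inner_neg_left]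
  congr 2
  simp only [Complex.conj_ofReal, Complex.conj_I]
  push_cast
  ring

theorem charFun_withDensity_ofReal {E : Type*} [NormedAddCommGroup E] [InnerProductSpace ℝ E]
    [FiniteDimensional ℝ E] [MeasurableSpace E] [BorelSpace E] {q : E → ℝ} (hq : Measurable q)
    (ξ : E) : charFun (volume.withDensity fun x => ENNReal.ofReal (q x)) ξ =
      ∫ x, ((max (q x) 0 : ℝ) : ℂ) * Complex.exp (inner ℝ x ξ * Complex.I) := by
  rw [charFun_apply, integral_withDensity_eq_integral_toReal_smul (by fun_prop)
    (Eventually.of_forall fun x => ENNReal.ofReal_lt_top)]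
  congr 1

/-- The transform `q` of `f` is real, and inversion shows that `μ + q⁻ dx` and `ν + q⁺ dx` have
equal characteristic functions, so they coincide. Thus `μ - ν` has density `q`, although neither
measure is assumed to have one. -/
theorem abs_measureReal_sub_le_of_charFun_sub {E : Type*} [NormedAddCommGroup E]
    [InnerProductSpace ℝ E] [FiniteDimensional ℝ E] [MeasurableSpace E] [BorelSpace E]
    (μ ν : Measure E) [IsFiniteMeasure μ] [IsFiniteMeasure ν] {f : E → ℂ}
    (hf : ∀ v, f v = charFun μ ((2 * Real.pi) • v) - charFun ν ((2 * Real.pi) • v))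
    (hfc : Continuous f) (hfi : Integrable f) (hFi : Integrable (𝓕 f)) {D : Set E}
    (hD : MeasurableSet D) : |μ.real D - ν.real D| ≤ ∫ w, ‖𝓕 f w‖ := by
  have hherm : ∀ v, f (-v) = starRingEnd ℂ (f v) := by
    intro v
    rw [hf, hf, smul_neg, charFun_neg, charFun_neg, map_sub]
  have hFc : Continuous (𝓕 f) := VectorFourier.fourierIntegral_continuous
    Real.continuous_fourierChar (by exact continuous_inner) hfi
  set q : E → ℝ := fun w => (𝓕 f w).re with hq
  have hqc : Continuous q := Complex.continuous_re.comp hFc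
  have hqF : ∀ w, ((q w : ℝ) : ℂ) = 𝓕 f w := fun w =>
    Complex.conj_eq_iff_re.1 (conj_fourier_of_hermitian hherm w)
  have hqi : Integrable q := hFi.re
  have hqm : Measurable q := hqc.measurable
  have hinv : ∀ ξ, f ξ = ∫ x, Complex.exp (↑(2 * Real.pi * inner ℝ x ξ) * Complex.I) • 𝓕 f x := by
    intro ξ
    conv_lhs => rw [← hfc.fourierInv_fourier_eq hfi hFi]
    rw [Real.fourierInv_eq']
  set m₁ := μ + volume.withDensity fun x => ENNReal.ofReal (-q x) with hm₁
  set m₂ := ν + volume.withDensity fun x => ENNReal.ofReal (q x) with hm₂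
  have i₁ : IsFiniteMeasure (volume.withDensity fun x => ENNReal.ofReal (-q x)) :=
    isFiniteMeasure_withDensity_ofReal hqi.neg.2
  have i₂ : IsFiniteMeasure (volume.withDensity fun x => ENNReal.ofReal (q x)) :=
    isFiniteMeasure_withDensity_ofReal hqi.2
  have hexp : ∀ (g : E → ℝ) (ξ : E), Integrable g → Integrable fun x =>
      ((max (g x) 0 : ℝ) : ℂ) * Complex.exp (inner ℝ x ξ * Complex.I) := by
    intro g ξ hg
    refine (hg.pos_part.ofReal (𝕜 := ℂ)).mono
      ((hg.pos_part.ofReal (𝕜 := ℂ)).aestronglyMeasurable.mul (by fun_prop))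
      (Eventually.of_forall fun x => ?_)
    rw [norm_mul, Complex.norm_exp_ofReal_mul_I, mul_one]
    rfl
  have hadd : ∀ (m n : Measure E) [IsFiniteMeasure m] [IsFiniteMeasure n] (ξ : E),
      charFun (m + n) ξ = charFun m ξ + charFun n ξ := by
    intro m n _ _ ξ
    have hi : ∀ (k : Measure E) [IsFiniteMeasure k],
        Integrable (fun x => Complex.exp (inner ℝ x ξ * Complex.I)) k := fun k _ =>
      (integrable_const (1 : ℝ)).mono' (by fun_prop) (Eventually.of_forall fun x => by
        rw [Complex.norm_exp_ofReal_mul_I])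
    rw [charFun_apply, integral_add_measure (hi m) (hi n)]
    rfl
  have heq : m₁ = m₂ := by
    refine Measure.ext_of_charFun (funext fun ξ => ?_)
    rw [hm₁, hm₂, hadd, hadd, charFun_withDensity_ofReal hqm,
      charFun_withDensity_ofReal (q := fun x => -q x) hqm.neg]
    have h1 : charFun μ ξ - charFun ν ξ = f ((2 * Real.pi)⁻¹ • ξ) := by
      rw [hf, smul_inv_smul₀ (by positivity)]
    have h2 : f ((2 * Real.pi)⁻¹ • ξ) =
        (∫ x, ((max (q x) 0 : ℝ) : ℂ) * Complex.exp (inner ℝ x ξ * Complex.I)) -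
          ∫ x, ((max (-q x) 0 : ℝ) : ℂ) * Complex.exp (inner ℝ x ξ * Complex.I) := by
      rw [hinv, ← integral_sub (hexp q ξ hqi) (hexp (fun x => -q x) ξ hqi.neg)]
      congr 1
      ext x
      rw [← sub_mul, ← Complex.ofReal_sub, max_zero_sub_eq_self, hqF, smul_eq_mul, mul_comm,
        real_inner_smul_right, mul_inv_cancel_left₀ (by positivity)]
    rw [h2] at h1
    linear_combination h1
  have hD' : μ.real D + (volume.withDensity fun x => ENNReal.ofReal (-q x)).real D =
      ν.real D + (volume.withDensity fun x => ENNReal.ofReal (q x)).real D := by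
    rw [← measureReal_add_apply, ← measureReal_add_apply, ← hm₁, ← hm₂, heq]
  have hbound : ∀ g : E → ℝ, Integrable g → (∀ x, g x ≤ ‖𝓕 f x‖) →
      (volume.withDensity fun x => ENNReal.ofReal (g x)).real D ≤ ∫ w, ‖𝓕 f w‖ := by
    intro g hg hgF
    rw [measureReal_def, withDensity_apply _ hD]
    refine ENNReal.toReal_le_of_le_ofReal (integral_nonneg fun w => norm_nonneg _) ?_
    rw [ofReal_integral_eq_lintegral_ofReal hFi.norm (Eventually.of_forall fun w => norm_nonneg _)]
    exact (setLIntegral_le_lintegral _ _).trans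
      (lintegral_mono fun x => ENNReal.ofReal_le_ofReal (hgF x))
  have h1 := hbound q hqi fun x => (le_abs_self _).trans (Complex.abs_re_le_norm _)
  have h2 := hbound (fun x => -q x) hqi.neg fun x =>
    (neg_le_abs _).trans (Complex.abs_re_le_norm _)
  have h3 : 0 ≤ (volume.withDensity fun x => ENNReal.ofReal (q x)).real D := measureReal_nonneg
  have h4 : 0 ≤ (volume.withDensity fun x => ENNReal.ofReal (-q x)).real D := measureReal_nonneg
  rw [abs_le]
  constructor <;> linarith

/-- For an even real bump `ψ`, the convolution `ψ ⋆ ψ` is smooth with compact support and its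
transform is the square of a real function. Normalized by `(ψ ⋆ ψ)(0) = ∫ ψ² > 0`, that square is
the required density. -/
theorem exists_isProbabilityMeasure_charFun_hasCompactSupport (E : Type*) [NormedAddCommGroup E]
    [InnerProductSpace ℝ E] [FiniteDimensional ℝ E] [MeasurableSpace E] [BorelSpace E] :
    ∃ κ : Measure E, IsProbabilityMeasure κ ∧ ContDiff ℝ (⊤ : ℕ∞) (charFun κ) ∧
      HasCompactSupport (charFun κ) := by
  let b : ContDiffBump (0 : E) := ⟨1, 2, one_pos, one_lt_two⟩
  set ψ : E → ℂ := fun x => (b x : ℂ) with hψ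
  have hψc : HasCompactSupport ψ := b.hasCompactSupport.comp_left Complex.ofReal_zero
  have hψs : ContDiff ℝ (⊤ : ℕ∞) ψ := Complex.ofRealCLM.contDiff.comp b.contDiff
  have hψe : ∀ v, ψ (-v) = starRingEnd ℂ (ψ v) := by
    intro v
    simp only [hψ, Complex.conj_ofReal]
    rw [b.neg]
  set S : SchwartzMap E ℂ := hψc.toSchwartzMap hψs with hS
  have hSψ : (S : E → ℂ) = ψ := rfl
  set B := ContinuousLinearMap.mul ℂ ℂ with hB
  set φ : SchwartzMap E ℂ := SchwartzMap.convolution B S S with hφ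
  have hφconv : ∀ x, φ x = (MeasureTheory.convolution ψ ψ B volume) x := fun x => by
    rw [hφ, SchwartzMap.convolution_apply, hSψ]
  have hφc : HasCompactSupport φ := by
    have : (φ : E → ℂ) = MeasureTheory.convolution ψ ψ B volume := funext hφconv
    rw [this]
    exact hψc.convolution _ hψc
  set h : E → ℝ := fun w => (𝓕 ψ w).re ^ 2 with hh
  have hψre : ∀ w, ((𝓕 ψ w).re : ℂ) = 𝓕 ψ w := fun w =>
    Complex.conj_eq_iff_re.1 (conj_fourier_of_hermitian hψe w)
  have hFφ : ∀ w, 𝓕 (φ : E → ℂ) w = (h w : ℂ) := by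
    intro w
    rw [← SchwartzMap.fourier_coe, hφ, SchwartzMap.fourier_convolution,
      SchwartzMap.pairing_apply_apply, SchwartzMap.fourier_coe, hSψ, hh]
    push_cast
    rw [hψre, hB, ContinuousLinearMap.mul_apply', sq]
  have hFi : Integrable (𝓕 (φ : E → ℂ)) := by
    rw [← SchwartzMap.fourier_coe]
    exact (𝓕 φ).integrable
  have hhi : Integrable h := by
    refine hFi.re.congr (Eventually.of_forall fun w => ?_)
    simp [hFφ]
  have hhm : Measurable h := by
    have : Continuous fun w => (𝓕 (φ : E → ℂ) w).re := by
      rw [← SchwartzMap.fourier_coe]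
      exact Complex.continuous_re.comp (𝓕 φ).continuous
    simpa [hFφ] using this.measurable
  have hinv : ∀ ξ, φ ξ =
      ∫ x, (h x : ℂ) * Complex.exp (inner ℝ x ((2 * Real.pi) • ξ) * Complex.I) := by
    intro ξ
    conv_lhs => rw [← φ.continuous.fourierInv_fourier_eq φ.integrable hFi]
    rw [Real.fourierInv_eq']
    congr 1
    ext x
    rw [hFφ, smul_eq_mul, mul_comm, real_inner_smul_right]
  set c : ℝ := ∫ x, h x with hc
  have hφ0 : φ 0 = (c : ℂ) := by
    rw [hinv, hc, ← integral_complex_ofReal]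
    simp
  have hcpos : 0 < c := by
    have h1 : (c : ℂ) = ((∫ t, b t * b t : ℝ) : ℂ) := by
      rw [← hφ0, hφconv, MeasureTheory.convolution, ← integral_complex_ofReal]
      congr 1
      ext t
      simp [hB, hψ, b.neg]
    rw [Complex.ofReal_inj.1 h1]
    refine (b.continuous.mul b.continuous).integral_pos_of_hasCompactSupport_nonneg_nonzero
      (b.hasCompactSupport.mul_right) (fun x => mul_self_nonneg _) (x := 0) ?_
    have : b 0 = 1 := b.one_of_mem_closedBall (by simp [b])
    simp [this]
  have hq0 : ∀ x, 0 ≤ c⁻¹ * h x := fun x => mul_nonneg (by positivity) (sq_nonneg _)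
  refine ⟨volume.withDensity fun x => ENNReal.ofReal (c⁻¹ * h x), ⟨?_⟩, ?_⟩
  · rw [withDensity_apply _ MeasurableSet.univ, Measure.restrict_univ,
      ← ofReal_integral_eq_lintegral_ofReal (hhi.const_mul _) (Eventually.of_forall hq0),
      integral_const_mul, ← hc, inv_mul_cancel₀ hcpos.ne', ENNReal.ofReal_one]
  · have hcf : charFun (volume.withDensity fun x => ENNReal.ofReal (c⁻¹ * h x)) =
        fun ξ => (c : ℂ)⁻¹ * φ ((2 * Real.pi)⁻¹ • ξ) := by
      ext ξ
      rw [charFun_withDensity_ofReal (hhm.const_mul _), hinv, ← integral_const_mul]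
      congr 1
      ext x
      rw [max_eq_left (hq0 x), smul_inv_smul₀ (by positivity)]
      push_cast
      ring
    rw [hcf]
    constructor
    · exact contDiff_const.mul ((φ.smooth ⊤).comp (contDiff_const_smul _))
    · refine HasCompactSupport.mul_left ?_
      exact hφc.comp_homeomorph
        (Homeomorph.smulOfNeZero ((2 * Real.pi)⁻¹ : ℝ) (by positivity))

/-! ### Derivative estimates for rescaled functions times a Gaussian. -/

section IteratedFDerivBounds

variable {E F G : Type*} [NormedAddCommGroup E] [NormedSpace ℝ E] [NormedAddCommGroup F]
  [NormedSpace ℝ F] [NormedAddCommGroup G] [NormedSpace ℝ G]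

theorem norm_iteratedFDeriv_comp_clm_le (g : E →L[ℝ] F) {f : F → G} {n : ℕ∞}
    (hf : ContDiff ℝ n f) (x : E) {i : ℕ} (hi : i ≤ n) :
    ‖iteratedFDeriv ℝ i (fun y => f (g y)) x‖ ≤ ‖iteratedFDeriv ℝ i f (g x)‖ * ‖g‖ ^ i := by
  have := g.iteratedFDeriv_comp_right hf x (i := i) (by exact_mod_cast hi)
  rw [show (fun y => f (g y)) = f ∘ g from rfl, this]
  refine (ContinuousMultilinearMap.norm_compContinuousLinearMap_le _ _).trans_eq ?_
  simp

theorem norm_iteratedFDeriv_mul_le_of_le {f g : E → ℂ} {n : ℕ∞} (hf : ContDiff ℝ n f)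
    (hg : ContDiff ℝ n g) {x : E} {j : ℕ} (hj : j ≤ n) {a b : ℝ}
    (ha : ∀ i ≤ j, ‖iteratedFDeriv ℝ i f x‖ ≤ a) (hb : ∀ i ≤ j, ‖iteratedFDeriv ℝ i g x‖ ≤ b) :
    ‖iteratedFDeriv ℝ j (fun y => f y * g y) x‖ ≤ 2 ^ j * (a * b) := by
  have ha0 : 0 ≤ a := (norm_nonneg _).trans (ha 0 (by omega))
  refine (norm_iteratedFDeriv_mul_le hf hg x (by exact_mod_cast hj)).trans ?_
  calc _ ≤ ∑ i ∈ Finset.range (j + 1), (j.choose i : ℝ) * (a * b) := by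
        refine Finset.sum_le_sum fun i hi => ?_
        rw [mul_assoc]
        refine mul_le_mul_of_nonneg_left ?_ (by positivity)
        exact mul_le_mul (ha i (by grind)) (hb _ (by omega)) (norm_nonneg _) ha0
    _ = 2 ^ j * (a * b) := by
        rw [← Finset.sum_mul]
        congr 1
        exact_mod_cast Nat.sum_range_choose j

theorem norm_le_of_iteratedFDeriv_two_le {W : E → G} (hW : ContDiff ℝ 2 W) {L : ℝ}
    (hL : ∀ x, ‖iteratedFDeriv ℝ 2 W x‖ ≤ L) (h0 : W 0 = 0) (h1 : fderiv ℝ W 0 = 0) (x : E) :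
    ‖fderiv ℝ W x‖ ≤ L * ‖x‖ ∧ ‖W x‖ ≤ L * ‖x‖ ^ 2 := by
  have hL0 : 0 ≤ L := (norm_nonneg _).trans (hL 0)
  have hD : ∀ x, ‖fderiv ℝ W x‖ ≤ L * ‖x‖ := by
    intro x
    have hd : ContDiff ℝ 1 (fderiv ℝ W) := hW.fderiv_right (by norm_num)
    have := convex_univ.norm_image_sub_le_of_norm_fderiv_le (𝕜 := ℝ) (f := fderiv ℝ W) (C := L)
      (fun y _ => (hd.differentiable (by norm_num)) y) (fun y _ => ?_) (Set.mem_univ 0)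
      (Set.mem_univ x)
    · simpa [h1] using this
    · rw [← norm_iteratedFDeriv_one, norm_iteratedFDeriv_fderiv]
      exact hL y
  refine ⟨hD x, ?_⟩
  have := (convex_closedBall (0 : E) ‖x‖).norm_image_sub_le_of_norm_fderiv_le (𝕜 := ℝ) (f := W)
    (C := L * ‖x‖) (fun y _ => (hW.differentiable (by norm_num)) y) (fun y hy => ?_)
    (x := 0) (y := x) (by simp) (by simp)
  · rw [h0, sub_zero, sub_zero] at this
    rwa [sq, ← mul_assoc]
  · exact (hD y).trans (mul_le_mul_of_nonneg_left (by simpa using hy) hL0)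

/-- The rescaling by `c` of a function vanishing to second order at the origin is `O(c²)` together
with its derivatives. -/
theorem norm_iteratedFDeriv_comp_smul_le {W : E → G} {N : ℕ} (hN : 2 ≤ N)
    (hW : ContDiff ℝ (N : ℕ∞) W) {L : ℝ} (hL : ∀ j ≤ N, ∀ x, ‖iteratedFDeriv ℝ j W x‖ ≤ L)
    (h0 : W 0 = 0) (h1 : fderiv ℝ W 0 = 0) {c : ℝ} (hc0 : 0 ≤ c) (hc1 : c ≤ 1) {j : ℕ}
    (hj : j ≤ N) (x : E) :
    ‖iteratedFDeriv ℝ j (fun y => W (c • y)) x‖ ≤ L * c ^ 2 * (1 + ‖x‖) ^ 2 := by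
  have hL0 : 0 ≤ L := (norm_nonneg _).trans (hL 0 (by omega) 0)
  have hW2 : ContDiff ℝ 2 W := 
    hW.of_le (WithTop.coe_le_coe.2 (Nat.cast_le.2 hN : ((2 : ℕ) : ℕ∞) ≤ N))
  obtain ⟨hD, hV⟩ := norm_le_of_iteratedFDeriv_two_le hW2 (hL 2 hN) h0 h1 (c • x)
  have hc : ‖c • ContinuousLinearMap.id ℝ E‖ ≤ c := by
    rw [norm_smul, Real.norm_of_nonneg hc0]
    exact mul_le_of_le_one_right hc0 ContinuousLinearMap.norm_id_le
  have hx1 : 1 ≤ 1 + ‖x‖ := le_add_of_nonneg_right (norm_nonneg x)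
  have hx2 : ‖x‖ ≤ 1 + ‖x‖ := by linarith
  have hcx : ‖c • x‖ = c * ‖x‖ := by rw [norm_smul, Real.norm_of_nonneg hc0]
  have hcomp := norm_iteratedFDeriv_comp_clm_le (c • ContinuousLinearMap.id ℝ E) hW x (i := j)
    (by exact_mod_cast hj)
  simp only [FunLike.coe_smul, ContinuousLinearMap.coe_id', Pi.smul_apply,
    id_eq] at hcomp
  have hcomp' := hcomp.trans (mul_le_mul_of_nonneg_left (pow_le_pow_left₀ (norm_nonneg _) hc j)
    (norm_nonneg _))
  refine hcomp'.trans ?_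
  -- Order `0` uses the quadratic bound on `W`; order `1` gains one factor `c` from the linear bound
  -- on its differential and one from the chain rule; higher orders gain `c ^ j ≤ c ^ 2` from the
  -- chain rule alone.
  match j with
  | 0 =>
    rw [norm_iteratedFDeriv_zero, pow_zero, mul_one]
    refine hV.trans ?_
    rw [hcx, mul_pow, ← mul_assoc]
    gcongr
  | 1 =>
    rw [norm_iteratedFDeriv_one, pow_one]
    calc ‖fderiv ℝ W (c • x)‖ * c ≤ L * ‖c • x‖ * c := by gcongr
      _ = L * c ^ 2 * ‖x‖ := by rw [hcx]; ring
      _ ≤ L * c ^ 2 * (1 + ‖x‖) ^ 2 := by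
        gcongr
        nlinarith [norm_nonneg x]
  | j + 2 =>
    calc ‖iteratedFDeriv ℝ (j + 2) W (c • x)‖ * c ^ (j + 2) ≤ L * c ^ 2 := by
          exact mul_le_mul (hL _ hj _) (pow_le_pow_of_le_one hc0 hc1 (by omega)) (by positivity) hL0
      _ ≤ L * c ^ 2 * (1 + ‖x‖) ^ 2 := by
          refine le_mul_of_one_le_right (by positivity) ?_
          exact one_le_pow₀ hx1

end IteratedFDerivBounds

/-- A single term of the exponential series at `a (1 + r²)` dominates the polynomial. -/
theorem one_add_pow_mul_exp_neg_le {a : ℝ} (ha : 0 < a) (q : ℕ) :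
    ∃ C : ℝ, 0 ≤ C ∧ ∀ r : ℝ, 0 ≤ r → (1 + r) ^ q * Real.exp (-(a * r ^ 2)) ≤ C := by
  refine ⟨2 ^ q * q.factorial / a ^ q * Real.exp a, by positivity, fun r hr => ?_⟩
  have h1 : (1 + r) ^ q ≤ 2 ^ q * (1 + r ^ 2) ^ q := by
    rw [← mul_pow]
    refine pow_le_pow_left₀ (by positivity) ?_ q
    nlinarith [sq_nonneg (r - 1), sq_nonneg r]
  have h2 : (a * (1 + r ^ 2)) ^ q / q.factorial ≤ Real.exp (a * (1 + r ^ 2)) :=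
    Real.pow_div_factorial_le_exp _ (by positivity) q
  have h3 : (1 + r ^ 2) ^ q ≤ q.factorial / a ^ q * (Real.exp a * Real.exp (a * r ^ 2)) := by
    rw [div_le_iff₀ (by positivity), mul_pow, mul_add, mul_one, Real.exp_add] at h2
    rw [div_mul_eq_mul_div, le_div_iff₀ (by positivity)]
    linarith
  rw [Real.exp_neg, ← div_eq_mul_inv, div_le_iff₀ (Real.exp_pos _)]
  refine h1.trans ((mul_le_mul_of_nonneg_left h3 (by positivity)).trans_eq ?_)
  ring

section Gaussian

variable {E : Type*} [NormedAddCommGroup E] [InnerProductSpace ℝ E]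

theorem contDiff_cexp_neg_norm_sq (a : ℝ) {n : ℕ∞} :
    ContDiff ℝ n fun v : E => (Real.exp (-(a * ‖v‖ ^ 2)) : ℂ) :=
  Complex.ofRealCLM.contDiff.comp
    (Real.contDiff_exp.comp (contDiff_const.mul (contDiff_norm_sq ℝ)).neg)

/-- All derivatives of `exp` equal `exp`, so the Faà di Bruno bound gives the Gaussian times a
polynomial coming from the temperate growth of the exponent. -/
theorem exists_norm_iteratedFDeriv_exp_neg_norm_sq_le {a : ℝ} (ha : 0 < a) (N p : ℕ) :
    ∃ C : ℝ, 0 ≤ C ∧ ∀ j ≤ N, ∀ v : E, (1 + ‖v‖) ^ p *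
      ‖iteratedFDeriv ℝ j (fun v : E => (Real.exp (-(a * ‖v‖ ^ 2)) : ℂ)) v‖ ≤ C := by
  have htg : (fun v : E => -(a * ‖v‖ ^ 2)).HasTemperateGrowth :=
    ((Function.HasTemperateGrowth.const a).mul
      (Function.hasTemperateGrowth_norm_sq E)).neg
  obtain ⟨k, C₀, hC₀, hk⟩ := htg.norm_iteratedFDeriv_le_uniform N
  obtain ⟨C₁, hC₁, hq⟩ := one_add_pow_mul_exp_neg_le ha (p + k * N)
  refine ⟨N.factorial * (1 + C₀) ^ N * C₁, by positivity, fun j hj v => ?_⟩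
  have hv : 1 ≤ 1 + ‖v‖ := le_add_of_nonneg_right (norm_nonneg v)
  have hsm : ContDiff ℝ N fun v : E => -(a * ‖v‖ ^ 2) :=
    (contDiff_const.mul (contDiff_norm_sq ℝ)).neg
  set D := (1 + C₀) * (1 + ‖v‖) ^ k with hD
  have hD1 : 1 ≤ D := one_le_mul_of_one_le_of_one_le (by linarith) (one_le_pow₀ hv)
  have h1 : ‖iteratedFDeriv ℝ j (Real.exp ∘ fun v : E => -(a * ‖v‖ ^ 2)) v‖ ≤
      j.factorial * Real.exp (-(a * ‖v‖ ^ 2)) * D ^ j := by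
    refine norm_iteratedFDeriv_comp_le (N := N) Real.contDiff_exp hsm (by exact_mod_cast hj) v
      (fun i _ => ?_) (fun i hi hij => ?_)
    · rw [norm_iteratedFDeriv_eq_norm_iteratedDeriv, iteratedDeriv_eq_iterate, Real.iter_deriv_exp,
        Real.norm_of_nonneg (Real.exp_nonneg _)]
    · refine (hk i (hij.trans hj) v).trans ?_
      calc C₀ * (1 + ‖v‖) ^ k ≤ D := by
            rw [hD]; gcongr; linarith
        _ ≤ D ^ i := le_self_pow₀ hD1 (by omega)
  have h2 : ‖iteratedFDeriv ℝ j (fun v : E => (Real.exp (-(a * ‖v‖ ^ 2)) : ℂ)) v‖ =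
      ‖iteratedFDeriv ℝ j (Real.exp ∘ fun v : E => -(a * ‖v‖ ^ 2)) v‖ :=
    Complex.ofRealLI.norm_iteratedFDeriv_comp_left (n := N)
      (f := Real.exp ∘ fun v : E => -(a * ‖v‖ ^ 2))
      (Real.contDiff_exp.comp hsm).contDiffAt (by exact_mod_cast hj)
  rw [h2]
  calc _ ≤ (1 + ‖v‖) ^ p * (N.factorial * Real.exp (-(a * ‖v‖ ^ 2)) * D ^ N) := by
        refine mul_le_mul_of_nonneg_left (h1.trans ?_) (by positivity)
        gcongr
    _ = N.factorial * (1 + C₀) ^ N * ((1 + ‖v‖) ^ (p + k * N) * Real.exp (-(a * ‖v‖ ^ 2))) := by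
        rw [hD, mul_pow, ← pow_mul, pow_add]; ring
    _ ≤ N.factorial * (1 + C₀) ^ N * C₁ := by
        gcongr
        exact hq _ (norm_nonneg v)

end Gaussian

/-- The Sobolev norm of `v ↦ W (c v) exp (-a |v|²)`, where `W` vanishes to second order at `0`. -/
theorem exists_sobolevSum_le {d : ℕ} (hd : 1 ≤ d) {a : ℝ} (ha : 0 < a) : ∃ C : ℝ, 0 ≤ C ∧
    ∀ (W : EuclideanSpace ℝ (Fin d) → ℂ) (L c : ℝ), ContDiff ℝ ((d + 1 : ℕ) : ℕ∞) W →
      (∀ j ≤ d + 1, ∀ x, ‖iteratedFDeriv ℝ j W x‖ ≤ L) → W 0 = 0 → fderiv ℝ W 0 = 0 →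
      0 ≤ c → c ≤ 1 →
      ContDiff ℝ ((d + 1 : ℕ) : ℕ∞)
        (fun v => W (c • v) * (Real.exp (-(a * ‖v‖ ^ 2)) : ℂ)) ∧
      (∀ j ≤ d + 1, Integrable
        (iteratedFDeriv ℝ j (fun v => W (c • v) * (Real.exp (-(a * ‖v‖ ^ 2)) : ℂ)))) ∧
      sobolevSum (d + 1) (fun v => W (c • v) * (Real.exp (-(a * ‖v‖ ^ 2)) : ℂ)) ≤
        C * (L * c ^ 2) := by
  -- In the weight, `2` pays for the quadratic growth of `W (c • v)` and `d + 1` leaves an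
  -- integrable tail.
  obtain ⟨C₀, hC₀, hG⟩ := exists_norm_iteratedFDeriv_exp_neg_norm_sq_le
    (E := EuclideanSpace ℝ (Fin d)) ha (d + 1) (2 + (d + 1))
  set I : ℝ := ∫ w : EuclideanSpace ℝ (Fin d), (1 + ‖w‖) ^ (-((d + 1 : ℕ) : ℝ)) with hI
  have hint : Integrable fun w : EuclideanSpace ℝ (Fin d) => (1 + ‖w‖) ^ (-((d + 1 : ℕ) : ℝ)) :=
    integrable_one_add_norm (by simp)
  have hI0 : 0 ≤ I := integral_nonneg fun w => by positivity
  refine ⟨(d + 2) * (2 ^ (d + 1) * C₀ * I), by positivity,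
    fun W L c hW hL h0 h1 hc0 hc1 => ?_⟩
  have hL0 : 0 ≤ L := (norm_nonneg _).trans (hL 0 (by omega) 0)
  have hWc : ContDiff ℝ ((d + 1 : ℕ) : ℕ∞) fun v : EuclideanSpace ℝ (Fin d) => W (c • v) :=
    hW.comp (contDiff_const_smul c)
  set f := fun v : EuclideanSpace ℝ (Fin d) => W (c • v) * (Real.exp (-(a * ‖v‖ ^ 2)) : ℂ) with hf
  have hfc : ContDiff ℝ ((d + 1 : ℕ) : ℕ∞) f := hWc.mul (contDiff_cexp_neg_norm_sq a)
  have hpt : ∀ j ≤ d + 1, ∀ v, ‖iteratedFDeriv ℝ j f v‖ ≤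
      2 ^ (d + 1) * (L * c ^ 2 * C₀) * (1 + ‖v‖) ^ (-((d + 1 : ℕ) : ℝ)) := by
    intro j hj v
    have hv : 0 < 1 + ‖v‖ := by positivity
    have := norm_iteratedFDeriv_mul_le_of_le (x := v) (j := j) hWc
      (contDiff_cexp_neg_norm_sq (E := EuclideanSpace ℝ (Fin d)) a) (by exact_mod_cast hj)
      (a := L * c ^ 2 * (1 + ‖v‖) ^ 2) (b := C₀ / (1 + ‖v‖) ^ (2 + (d + 1)))
      (fun i hi => norm_iteratedFDeriv_comp_smul_le (by omega) hW hL h0 h1 hc0 hc1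
        (hi.trans hj) v)
      (fun i hi => by rw [le_div_iff₀' (by positivity)]; exact hG i (hi.trans hj) v)
    refine this.trans ?_
    rw [Real.rpow_neg (by positivity), Real.rpow_natCast]
    have h2 : (2 : ℝ) ^ j ≤ 2 ^ (d + 1) := pow_le_pow_right₀ one_le_two hj
    calc _ ≤ 2 ^ (d + 1) *
          (L * c ^ 2 * (1 + ‖v‖) ^ 2 * (C₀ / (1 + ‖v‖) ^ (2 + (d + 1)))) := by gcongr
      _ = _ := by
        rw [pow_add (1 + ‖v‖)]
        field_simp
  have hci : ∀ j ≤ d + 1, Integrable (iteratedFDeriv ℝ j f) := fun j hj =>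
    (hint.const_mul _).mono' (hfc.continuous_iteratedFDeriv
      (by exact_mod_cast hj)).aestronglyMeasurable (Eventually.of_forall (hpt j hj))
  refine ⟨hfc, hci, ?_⟩
  calc sobolevSum (d + 1) f
      ≤ ∑ _j ∈ Finset.range (d + 1 + 1), 2 ^ (d + 1) * (L * c ^ 2 * C₀) * I := by
        refine Finset.sum_le_sum fun j hj => ?_
        have hj' : j ≤ d + 1 := by grind
        rw [hI, ← integral_const_mul]
        exact integral_mono (hci j hj').norm (hint.const_mul _) (hpt j hj')
    _ = _ := by
        rw [Finset.sum_const, Finset.card_range, nsmul_eq_mul]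
        push_cast
        ring

/-! ### The centred and standardized case. -/

theorem exists_closedBall_measureReal_ge {E : Type*} [NormedAddCommGroup E] [MeasurableSpace E]
    [BorelSpace E] (κ : Measure E) [IsProbabilityMeasure κ] :
    ∃ r : ℝ, 0 < r ∧ 3 / 4 ≤ κ.real (Metric.closedBall 0 r) := by
  have h : Tendsto (fun n : ℕ => κ (Metric.closedBall (0 : E) n)) atTop (𝓝 1) := by
    have := tendsto_measure_iUnion_atTop (μ := κ) (s := fun n : ℕ => Metric.closedBall (0 : E) n)
      (fun m n hmn => Metric.closedBall_subset_closedBall (by exact_mod_cast hmn))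
    rwa [Metric.iUnion_closedBall_nat, measure_univ] at this
  have h' : Tendsto (fun n : ℕ => κ.real (Metric.closedBall (0 : E) n)) atTop (𝓝 1) :=
    (ENNReal.tendsto_toReal ENNReal.one_ne_top).comp h
  obtain ⟨n, hn, hn0⟩ := ((h'.eventually (lt_mem_nhds (by norm_num : (3 / 4 : ℝ) < 1))).and
    (eventually_gt_atTop 0)).exists
  exact ⟨n, by exact_mod_cast hn0, hn.le⟩

theorem exists_norm_iteratedFDeriv_le_of_hasCompactSupport {E F : Type*} [NormedAddCommGroup E]
    [NormedSpace ℝ E] [NormedAddCommGroup F] [NormedSpace ℝ F] {f : E → F} {N : ℕ}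
    (hf : ContDiff ℝ (N : ℕ∞) f) (hc : HasCompactSupport f) :
    ∃ C : ℝ, 0 ≤ C ∧ ∀ j ≤ N, ∀ x, ‖iteratedFDeriv ℝ j f x‖ ≤ C := by
  have h : ∀ j : ℕ, ∃ C : ℝ, j ≤ N → ∀ x, ‖iteratedFDeriv ℝ j f x‖ ≤ C := by
    intro j
    by_cases hj : j ≤ N
    · obtain ⟨C, hC⟩ := (hc.iteratedFDeriv j).exists_bound_of_continuous
        (hf.continuous_iteratedFDeriv (by exact_mod_cast hj))
      exact ⟨C, fun _ => hC⟩
    · exact ⟨0, fun h => absurd h hj⟩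
  choose C hC using h
  refine ⟨∑ j ∈ Finset.range (N + 1), |C j|, Finset.sum_nonneg fun _ _ => abs_nonneg _,
    fun j hj x => ((hC j hj x).trans (le_abs_self _)).trans ?_⟩
  exact Finset.single_le_sum (f := fun j => |C j|) (fun _ _ => abs_nonneg _)
    (Finset.mem_range.2 (by omega))

theorem stdGaussian_real_boundaryShell_le {d : ℕ} {C : Set (EuclideanSpace ℝ (Fin d))}
    (hC : Convex ℝ C) {ε : ℝ} (hε : 0 ≤ ε) :
    (stdGaussian (EuclideanSpace ℝ (Fin d))).real (boundaryShell ε C) ≤ 4 * (d * √d) * ε :=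
  ENNReal.toReal_le_of_le_ofReal (by positivity) (stdGaussian_boundaryShell_le hC hε)

/-- If the characteristic functions of `μ n` are `gₙ(ξ / √tₙ) exp (-|ξ|² / 2)`, where the `gₙ - 1`
vanish to second order at the origin and are locally bounded in `C^{d+1}`, then `μ n` is at distance
`o(1 / √tₙ)` from the standard Gaussian measure. -/
theorem eventually_convexDist_stdGaussian_le {d : ℕ} (hd : 1 ≤ d)
    (μ : ℕ → Measure (EuclideanSpace ℝ (Fin d))) [∀ n, IsProbabilityMeasure (μ n)] {t : ℕ → ℝ}
    (ht : Tendsto t atTop atTop) (g : ℕ → EuclideanSpace ℝ (Fin d) → ℂ)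
    (hg : ∀ n, ContDiff ℝ ((d + 1 : ℕ) : ℕ∞) (g n)) (hg0 : ∀ n, g n 0 = 1)
    (hg1 : ∀ n, fderiv ℝ (g n) 0 = 0)
    (hbd : ∀ R : ℝ, ∃ L : ℝ, ∀ n, ∀ j ≤ d + 1, ∀ x, ‖x‖ ≤ R → ‖iteratedFDeriv ℝ j (g n) x‖ ≤ L)
    (hchar : ∀ n, 0 < t n → ∀ ξ, charFun (μ n) ξ =
      g n ((√(t n))⁻¹ • ξ) * (Real.exp (-(1 / 2 * ‖ξ‖ ^ 2)) : ℂ)) {η : ℝ} (hη : 0 < η) :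
    ∀ᶠ n in atTop, convexDist (μ n) (stdGaussian (EuclideanSpace ℝ (Fin d))) ≤ η / √(t n) := by
  obtain ⟨κ, hκ, hκs, hκc⟩ := exists_isProbabilityMeasure_charFun_hasCompactSupport
    (EuclideanSpace ℝ (Fin d))
  obtain ⟨r, hr, hκr⟩ := exists_closedBall_measureReal_ge κ
  obtain ⟨C₁, hC₁, hfour⟩ := exists_integral_norm_fourier_le d
  -- The constant `2π²` is `|2πv|²/2` with `|v| = 1`, from the normalization of `𝓕`.
  obtain ⟨C₂, hC₂, hsob⟩ := exists_sobolevSum_le hd (a := 2 * Real.pi ^ 2) (by positivity)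
  have hd0 : (0 : ℝ) < d := by exact_mod_cast hd
  have hsd0 : (0 : ℝ) < √d := Real.sqrt_pos.2 hd0
  -- Chosen so that the shell term `3/2 · 4d√d · 3rs/√t` is exactly half of `η/√t`.
  set s : ℝ := η / (36 * (d * √d) * r) with hs
  have hs0 : 0 < s := by positivity
  -- The kernel's characteristic function in the variable `ζ = ξ/√t`: its support does not depend on
  -- `n`, so the local bounds on `g n` become global bounds on `W n`.
  set χ : EuclideanSpace ℝ (Fin d) → ℂ := fun ζ => charFun κ (s • ζ) with hχ
  have hχs : ContDiff ℝ ((d + 1 : ℕ) : ℕ∞) χ :=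
    (hκs.of_le (by exact_mod_cast le_top)).comp (contDiff_const_smul s)
  have hχc : HasCompactSupport χ :=
    hκc.comp_homeomorph (Homeomorph.smulOfNeZero s hs0.ne')
  obtain ⟨A, hA, hAχ⟩ := exists_norm_iteratedFDeriv_le_of_hasCompactSupport hχs hχc
  obtain ⟨R, hR⟩ := hχc.isBounded.subset_closedBall 0
  obtain ⟨L₀, hL₀⟩ := hbd R
  set W : ℕ → EuclideanSpace ℝ (Fin d) → ℂ := fun n ζ => χ ζ * (g n ζ - 1) with hW
  have hg' : ∀ n, ContDiff ℝ ((d + 1 : ℕ) : ℕ∞) fun ζ => g n ζ - 1 :=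
    fun n => (hg n).sub contDiff_const
  have hWs : ∀ n, ContDiff ℝ ((d + 1 : ℕ) : ℕ∞) (W n) := fun n => hχs.mul (hg' n)
  have hgb : ∀ n, ∀ j ≤ d + 1, ∀ x, ‖x‖ ≤ R →
      ‖iteratedFDeriv ℝ j (fun ζ => g n ζ - 1) x‖ ≤ |L₀| + 1 := by
    intro n j hj x hx
    have h1 := (hL₀ n j hj x hx).trans (le_abs_self _)
    rcases Nat.eq_zero_or_pos j with rfl | hj0
    · rw [norm_iteratedFDeriv_zero] at h1 ⊢
      refine (norm_sub_le _ _).trans ?_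
      rw [norm_one]
      linarith
    · rw [show (fun ζ => g n ζ - 1) = g n - fun _ => (1 : ℂ) from rfl,
        iteratedFDeriv_sub_apply ((hg n).of_le (by exact_mod_cast hj)).contDiffAt
        contDiff_const.contDiffAt, iteratedFDeriv_const_of_ne hj0.ne', Pi.zero_apply, sub_zero]
      linarith
  set L : ℝ := 2 ^ (d + 1) * (A * (|L₀| + 1)) with hL
  have hL0 : 0 ≤ L := by positivity
  have hWb : ∀ n, ∀ j ≤ d + 1, ∀ x, ‖iteratedFDeriv ℝ j (W n) x‖ ≤ L := by
    intro n j hj x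
    by_cases hx : x ∈ tsupport χ
    · have hxR : ‖x‖ ≤ R := by simpa using hR hx
      refine (norm_iteratedFDeriv_mul_le_of_le hχs (hg' n) (by exact_mod_cast hj)
        (fun i hi => hAχ i (hi.trans hj) x) (fun i hi => hgb n i (hi.trans hj) x hxR)).trans ?_
      rw [hL]
      gcongr
      exact one_le_two
    · have h1 : x ∉ tsupport (W n) := fun h => hx (tsupport_mul_subset_left h)
      have h2 : iteratedFDeriv ℝ j (W n) x = 0 := by
        by_contra h
        exact h1 (support_iteratedFDeriv_subset j h)
      rw [h2, norm_zero]
      exact hL0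
  have hW0 : ∀ n, W n 0 = 0 := fun n => by simp [hW, hg0]
  have hW1 : ∀ n, fderiv ℝ (W n) 0 = 0 := by
    intro n
    have hne : (((d + 1 : ℕ) : ℕ∞) : WithTop ℕ∞) ≠ 0 := by exact_mod_cast Nat.succ_ne_zero d
    rw [hW, fderiv_fun_mul (hχs.differentiable hne).differentiableAt
      ((hg' n).differentiable hne).differentiableAt, fderiv_sub_const, hg1, hg0, sub_self]
    ext x; simp
  -- The second condition gives `c ≤ 1`; the third puts the `O(1/t)` smoothed term below the other
  -- half of `η/√t`.
  have hev : ∀ᶠ n in atTop, 1 ≤ t n ∧ (2 * Real.pi) ^ 2 ≤ t n ∧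
      4 * (C₁ * (C₂ * L)) * (2 * Real.pi) ^ 2 / η ≤ √(t n) :=
    (ht.eventually_ge_atTop 1).and ((ht.eventually_ge_atTop _).and
      ((Real.tendsto_sqrt_atTop.comp ht).eventually_ge_atTop _))
  filter_upwards [hev] with n hn
  obtain ⟨hn1, hn2, hn3⟩ := hn
  have htn : 0 < t n := by linarith
  have hst : 0 < √(t n) := Real.sqrt_pos.2 htn
  set ε : ℝ := s / √(t n) with hε
  have hε0 : 0 < ε := by positivity
  set κ' := κ.map (fun x => ε • x) with hκ'
  have hκ'p : IsProbabilityMeasure κ' := Measure.isProbabilityMeasure_map (by fun_prop)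
  have hball : 3 / 4 ≤ κ'.real (Metric.closedBall 0 (r * ε)) := by
    rw [hκ', map_measureReal_apply (by fun_prop) measurableSet_closedBall]
    refine hκr.trans (measureReal_mono fun x hx => ?_)
    simp only [Metric.mem_closedBall, dist_zero_right, Set.mem_preimage, norm_smul,
      Real.norm_of_nonneg hε0.le] at hx ⊢
    rw [mul_comm]
    gcongr
  set c : ℝ := 2 * Real.pi / √(t n) with hc
  have hc0 : 0 ≤ c := by positivity
  have hc1 : c ≤ 1 := by
    rw [hc, div_le_one hst]
    exact Real.le_sqrt_of_sq_le hn2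
  obtain ⟨hfs, hfi, hfS⟩ := hsob (W n) L c (hWs n) (hWb n) (hW0 n) (hW1 n) hc0 hc1
  set f : EuclideanSpace ℝ (Fin d) → ℂ := fun v => W n (c • v) * (Real.exp (-(2 * Real.pi ^ 2 * ‖v‖ ^ 2)) : ℂ) with hf
  obtain ⟨hFi, hFb⟩ := hfour f hfs hfi
  have hfint : Integrable f := by
    have := (hfi 0 (by omega)).norm
    simp only [norm_iteratedFDeriv_zero] at this
    exact (integrable_norm_iff hfs.continuous.aestronglyMeasurable).1 this
  have hfeq : ∀ v, f v = charFun ((μ n).conv κ') ((2 * Real.pi) • v) -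
      charFun ((stdGaussian _).conv κ') ((2 * Real.pi) • v) := by
    intro v
    have h1 : charFun κ' ((2 * Real.pi) • v) = χ (c • v) := by
      rw [hκ', charFun_map_smul, hχ]
      simp only [smul_smul]
      congr 2
      rw [hε, hc]
      ring
    have h2 : charFun (μ n) ((2 * Real.pi) • v) =
        g n (c • v) * (Real.exp (-(2 * Real.pi ^ 2 * ‖v‖ ^ 2)) : ℂ) := by
      rw [hchar n htn, smul_smul, norm_smul, Real.norm_of_nonneg (by positivity)]
      congr 3
      · rw [hc, div_eq_inv_mul]
      · congr 1
        ring
    have h3 : charFun (stdGaussian _) ((2 * Real.pi) • v) =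
        (Real.exp (-(2 * Real.pi ^ 2 * ‖v‖ ^ 2)) : ℂ) := by
      rw [charFun_stdGaussian, norm_smul, Real.norm_of_nonneg (by positivity)]
      push_cast
      congr 1
      ring
    rw [charFun_conv, charFun_conv, h1, h2, h3]
    simp only [hf, hW]
    ring
  have hT : ∀ D : Set (EuclideanSpace ℝ (Fin d)), MeasurableSet D →
      |((μ n).conv κ').real D - ((stdGaussian _).conv κ').real D| ≤
        C₁ * (C₂ * (L * c ^ 2)) := fun D hD =>
    (abs_measureReal_sub_le_of_charFun_sub _ _ hfeq hfs.continuous hfint hFi hD).trans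
      (hFb.trans (mul_le_mul_of_nonneg_left hfS hC₁))
  have hmain := convexDist_le_of_conv (μ n) (stdGaussian (EuclideanSpace ℝ (Fin d))) κ' (r := r * ε)
    (S := 4 * (d * √d) * (3 * (r * ε))) (by positivity) hball
    (fun C hC => stdGaussian_real_boundaryShell_le hC (by positivity)) hT
  have hS : 3 / 2 * (4 * (d * √d) * (3 * (r * ε))) = η / 2 / √(t n) := by
    rw [hε, hs]
    field_simp
    norm_num
  have hTT : 2 * (C₁ * (C₂ * (L * c ^ 2))) ≤ η / 2 / √(t n) := by
    rw [div_le_iff₀ hη] at hn3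
    rw [hc, div_pow, Real.sq_sqrt htn.le, le_div_iff₀ hst]
    have h4 : t n = √(t n) * √(t n) := (Real.mul_self_sqrt htn.le).symm
    have h5 : 2 * (C₁ * (C₂ * (L * ((2 * Real.pi) ^ 2 / t n)))) * √(t n) =
        2 * (C₁ * (C₂ * L)) * (2 * Real.pi) ^ 2 / √(t n) := by
      nth_rewrite 1 [h4]
      field_simp
    rw [h5, div_le_iff₀ hst]
    linarith
  calc convexDist (μ n) (stdGaussian (EuclideanSpace ℝ (Fin d))) ≤ _ := hmain
    _ ≤ η / 2 / √(t n) + η / 2 / √(t n) := add_le_add hTT hS.le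
    _ = η / √(t n) := by ring

/-! ### Uniform derivative bounds from mod-Gaussian convergence. -/

section PartialDerivatives

variable {d : ℕ}

theorem norm_le_sum_norm_apply_single {k : ℕ}
    (m : ContinuousMultilinearMap ℝ (fun _ : Fin k => EuclideanSpace ℝ (Fin d)) ℂ) :
    ‖m‖ ≤ ∑ i : Fin k → Fin d, ‖m fun j => EuclideanSpace.single (i j) (1 : ℝ)‖ := by
  refine ContinuousMultilinearMap.opNorm_le_bound (Finset.sum_nonneg fun _ _ => norm_nonneg _)
    fun v => ?_
  have hv : v = fun j => ∑ a, v j a • EuclideanSpace.single a (1 : ℝ) := by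
    ext j a
    simp [Finset.sum_apply, Pi.single_apply]
  conv_lhs => rw [hv, m.map_sum]
  rw [Finset.sum_mul]
  refine (norm_sum_le _ _).trans (Finset.sum_le_sum fun i _ => ?_)
  rw [m.map_smul_univ, norm_smul, mul_comm, norm_prod]
  gcongr with j _
  exact PiLp.norm_apply_le (v j) (i j)

theorem norm_partialDeriv_le {k : ℕ} (i : Fin k → Fin d) (f : EuclideanSpace ℝ (Fin d) → ℂ)
    (ζ : EuclideanSpace ℝ (Fin d)) : ‖partialDeriv i f ζ‖ ≤ ‖iteratedFDeriv ℝ k f ζ‖ := by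
  refine (ContinuousMultilinearMap.le_opNorm _ _).trans_eq ?_
  simp

theorem continuous_partialDeriv {k N : ℕ} (hk : k ≤ N) (i : Fin k → Fin d)
    {f : EuclideanSpace ℝ (Fin d) → ℂ} (hf : ContDiff ℝ (N : ℕ∞) f) :
    Continuous (partialDeriv i f) :=
  (ContinuousMultilinearMap.apply ℝ (fun _ : Fin k => EuclideanSpace ℝ (Fin d)) ℂ
    fun j => EuclideanSpace.single (i j) (1 : ℝ)).continuous.comp
    (hf.continuous_iteratedFDeriv (by exact_mod_cast hk))

end PartialDerivatives

/-- The tail is within `1` of the bounded limit; continuity on the compact set handles the finitely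
many remaining indices. -/
theorem TendstoUniformlyOn.exists_norm_le {α E : Type*} [TopologicalSpace α]
    [SeminormedAddCommGroup E] {F : ℕ → α → E} {f : α → E} {S : Set α}
    (h : TendstoUniformlyOn F f atTop S) (hS : IsCompact S) (hF : ∀ n, ContinuousOn (F n) S)
    (hf : ContinuousOn f S) : ∃ L : ℝ, ∀ n, ∀ x ∈ S, ‖F n x‖ ≤ L := by
  obtain ⟨N, hN⟩ := eventually_atTop.1 (Metric.tendstoUniformlyOn_iff.1 h 1 one_pos)
  obtain ⟨C, hC⟩ := hS.exists_bound_of_continuousOn hf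
  choose D hD using fun n => hS.exists_bound_of_continuousOn (hF n)
  refine ⟨|C| + 1 + ∑ n ∈ Finset.range N, |D n|, fun n x hx => ?_⟩
  rcases lt_or_ge n N with hn | hn
  · have h1 := (hD n x hx).trans (le_abs_self _)
    have h2 := Finset.single_le_sum (f := fun n => |D n|) (fun _ _ => abs_nonneg _)
      (Finset.mem_range.2 hn)
    have h3 := abs_nonneg C
    linarith
  · have h1 := (hC x hx).trans (le_abs_self _)
    have h2 := hN n hn x hx
    rw [dist_comm, dist_eq_norm] at h2
    have h3 := norm_add_le (F n x - f x) (f x)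
    rw [sub_add_cancel] at h3
    have h4 : 0 ≤ ∑ n ∈ Finset.range N, |D n| := Finset.sum_nonneg fun _ _ => abs_nonneg _
    linarith

namespace StrongModGaussian

variable {d : ℕ} {K : Matrix (Fin d) (Fin d) ℝ} {t : ℕ → ℝ}
  {μ : ℕ → Measure (EuclideanSpace ℝ (Fin d))} {θ : EuclideanSpace ℝ (Fin d) → ℂ}

theorem exists_norm_iteratedFDeriv_residue_le (h : StrongModGaussian K t μ θ) (R : ℝ) :
    ∃ L : ℝ, ∀ n, ∀ k ≤ d + 1, ∀ ζ, ‖ζ‖ ≤ R →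
      ‖iteratedFDeriv ℝ k (residue K (t n) (μ n)) ζ‖ ≤ L := by
  have hp : ∀ k : ℕ, ∀ i : Fin k → Fin d, ∃ L : ℝ, k ≤ d + 1 → ∀ n, ∀ ζ, ‖ζ‖ ≤ R →
      ‖partialDeriv i (residue K (t n) (μ n)) ζ‖ ≤ L := by
    intro k i
    by_cases hk : k ≤ d + 1
    · have hS : IsCompact (Metric.closedBall (0 : EuclideanSpace ℝ (Fin d)) R) :=
        isCompact_closedBall 0 R
      have hu := (tendstoLocallyUniformlyOn_iff_tendstoUniformlyOn_of_compact hS).1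
        (h.tendsto_partialDeriv k hk i).tendstoLocallyUniformlyOn
      obtain ⟨L, hL⟩ := hu.exists_norm_le hS
        (fun n => (continuous_partialDeriv hk i (h.contDiff_residue n)).continuousOn)
        (continuous_partialDeriv hk i h.contDiff_limit).continuousOn
      exact ⟨L, fun _ n ζ hζ => hL n ζ (by simpa using hζ)⟩
    · exact ⟨0, fun h => absurd h hk⟩
  choose L hL using hp
  refine ⟨∑ k ∈ Finset.range (d + 2), |∑ i : Fin k → Fin d, L k i|, fun n k hk ζ hζ => ?_⟩
  calc ‖iteratedFDeriv ℝ k (residue K (t n) (μ n)) ζ‖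
      ≤ ∑ i : Fin k → Fin d, ‖partialDeriv i (residue K (t n) (μ n)) ζ‖ :=
        norm_le_sum_norm_apply_single _
    _ ≤ ∑ i : Fin k → Fin d, L k i := Finset.sum_le_sum fun i _ => hL k i hk n ζ hζ
    _ ≤ |∑ i : Fin k → Fin d, L k i| := le_abs_self _
    _ ≤ _ := Finset.single_le_sum (f := fun k => |∑ i : Fin k → Fin d, L k i|)
        (fun _ _ => abs_nonneg _) (Finset.mem_range.2 (by omega))

theorem residueSup_ne_top (h : StrongModGaussian K t μ θ) (B : ℝ) : residueSup K t μ B ≠ ⊤ := by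
  obtain ⟨L, hL⟩ := h.exists_norm_iteratedFDeriv_residue_le
    (∑ _j : Fin d, B * (2 * d + 2 : ℝ) ^ (3 / 2 : ℝ))
  refine ne_top_of_le_ne_top (ENNReal.ofReal_ne_top (r := L)) ?_
  refine iSup_le fun n => iSup_le fun k => iSup_le fun hk => iSup_le fun i => iSup_le fun ζ =>
    iSup_le fun hζ => ?_
  rw [← ofReal_norm]
  refine ENNReal.ofReal_le_ofReal ((norm_partialDeriv_le i _ ζ).trans (hL n k hk ζ ?_))
  calc ‖ζ‖ = ‖∑ j, ζ j • EuclideanSpace.single j (1 : ℝ)‖ := by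
        congr 1
        ext a
        simp [Finset.sum_apply, Pi.single_apply]
    _ ≤ ∑ j, |ζ j| := (norm_sum_le _ _).trans_eq (by simp [norm_smul])
    _ ≤ _ := Finset.sum_le_sum fun j _ => hζ j

/-- The quantitative estimate uses `M(B)` only through the derivatives at the origin, which lies in
every cube. -/
theorem norm_partialDeriv_zero_le (h : StrongModGaussian K t μ θ) {B : ℝ} (hB : 0 ≤ B) (n : ℕ)
    {k : ℕ} (hk : k ≤ d + 1) (i : Fin k → Fin d) :
    ‖partialDeriv i (residue K (t n) (μ n)) 0‖ ≤ (residueSup K t μ B).toReal := by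
  rw [← ENNReal.ofReal_le_iff_le_toReal (h.residueSup_ne_top B), ofReal_norm]
  refine le_iSup_of_le n (le_iSup_of_le k (le_iSup_of_le hk (le_iSup_of_le i
    (le_iSup_of_le 0 (le_iSup_of_le (fun j => ?_) le_rfl)))))
  simp only [PiLp.zero_apply, abs_zero]
  positivity

end StrongModGaussian

/-! ### Centring by the residual mean and change of variables. -/

section Residue

variable {d : ℕ} (K : Matrix (Fin d) (Fin d) ℝ) (t : ℝ)
  (μ : Measure (EuclideanSpace ℝ (Fin d)))

theorem residue_zero [IsProbabilityMeasure μ] : residue K t μ 0 = 1 := by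
  simp [residue]

theorem residue_neg (ζ : EuclideanSpace ℝ (Fin d)) :
    residue K t μ (-ζ) = starRingEnd ℂ (residue K t μ ζ) := by
  rw [residue, residue, charFun_neg, map_mul, ← Complex.exp_conj, Complex.conj_ofReal]
  simp [Matrix.mulVec_neg]

/-- The vector `b` such that the differential at the origin of the residue is `i⟨b, ·⟩`; this is
the mean of `μ` when the latter exists. -/
noncomputable def residueMean : EuclideanSpace ℝ (Fin d) :=
  WithLp.toLp 2 fun j => (fderiv ℝ (residue K t μ) 0 (EuclideanSpace.single j 1)).im

variable {K t μ}

theorem fderiv_residue_zero (hd : Differentiable ℝ (residue K t μ))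
    (ζ : EuclideanSpace ℝ (Fin d)) :
    fderiv ℝ (residue K t μ) 0 ζ = (inner ℝ (residueMean K t μ) ζ : ℝ) * Complex.I := by
  set f := residue K t μ with hf
  -- Differentiating `f (-ζ) = conj (f ζ)` at `0` in two ways gives `-Df(0) = conj Df(0)`.
  have hre : ∀ v, (fderiv ℝ f 0 v).re = 0 := by
    intro v
    have h0 : HasFDerivAt f (fderiv ℝ f 0) (-(0 : EuclideanSpace ℝ (Fin d))) := by
      rw [neg_zero]
      exact (hd 0).hasFDerivAt
    have h1 : HasFDerivAt (fun ζ => f (-ζ)) (-(fderiv ℝ f 0)) 0 := by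
      have := h0.comp (0 : EuclideanSpace ℝ (Fin d)) (hasFDerivAt_id 0).neg
      refine this.congr_fderiv ?_
      ext v
      simp
    have h2 : HasFDerivAt (fun ζ => f (-ζ)) (Complex.conjCLE.toContinuousLinearMap.comp
        (fderiv ℝ f 0)) 0 := by
      have := Complex.conjCLE.toContinuousLinearMap.hasFDerivAt.comp
        (0 : EuclideanSpace ℝ (Fin d)) (hd 0).hasFDerivAt
      refine this.congr_of_eventuallyEq (Eventually.of_forall fun ζ => ?_)
      simp [hf, residue_neg]
    have h3 := congrArg (fun L => (L v).re) (h1.unique h2)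
    simp at h3
    linarith
  have him : (fderiv ℝ f 0 ζ).im = inner ℝ (residueMean K t μ) ζ := by
    have hζ : ζ = ∑ j, ζ j • EuclideanSpace.single j (1 : ℝ) := by
      ext a
      simp [Finset.sum_apply, Pi.single_apply]
    conv_lhs => rw [hζ, map_sum, Complex.im_sum]
    rw [PiLp.inner_apply]
    refine Finset.sum_congr rfl fun j _ => ?_
    rw [map_smul]
    simp [residueMean, hf]
  apply Complex.ext
  · simp [hre]
  · simp [him]

theorem norm_residueMean_le {M : ℝ}
    (hM : ∀ i : Fin 1 → Fin d, ‖partialDeriv i (residue K t μ) 0‖ ≤ M) (hM0 : 0 ≤ M) :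
    ‖residueMean K t μ‖ ≤ √d * M := by
  rw [EuclideanSpace.norm_eq]
  refine (Real.sqrt_le_sqrt (Finset.sum_le_sum (g := fun _ => M ^ 2) fun j _ => ?_)).trans_eq ?_
  · refine pow_le_pow_left₀ (norm_nonneg _) ?_ 2
    refine le_trans ?_ (hM fun _ => j)
    rw [partialDeriv, iteratedFDeriv_one_apply]
    exact Complex.abs_im_le_norm _
  · rw [Finset.sum_const, Finset.card_univ, Fintype.card_fin, nsmul_eq_mul,
      Real.sqrt_mul (Nat.cast_nonneg d), Real.sqrt_sq hM0]

end Residue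

/-- A convex set and its translate by `h` differ only inside the shell of width `‖h‖`. -/
theorem abs_stdGaussian_translate_sub_le {d : ℕ} {C : Set (EuclideanSpace ℝ (Fin d))}
    (hC : Convex ℝ C) (h : EuclideanSpace ℝ (Fin d)) :
    |(stdGaussian (EuclideanSpace ℝ (Fin d))).real {y | y + h ∈ C} -
      (stdGaussian (EuclideanSpace ℝ (Fin d))).real C| ≤ 4 * (d * √d) * ‖h‖ := by
  have hsh := stdGaussian_real_boundaryShell_le hC (norm_nonneg h)
  have hd : ∀ y, dist y (y + h) ≤ ‖h‖ := fun y => by simp [dist_eq_norm]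
  have h1 := measureReal_le_add_of_subset_union (stdGaussian (EuclideanSpace ℝ (Fin d)))
    (A := {y | y + h ∈ C}) (B := C) (C := boundaryShell ‖h‖ C) (fun y hy => by
      by_cases hyC : y ∈ C
      · exact Or.inl hyC
      · exact Or.inr ⟨⟨_, hy, hd y⟩, y, hyC, by rw [dist_self]; exact norm_nonneg h⟩)
  have h2 := measureReal_le_add_of_subset_union (stdGaussian (EuclideanSpace ℝ (Fin d)))
    (A := C) (B := {y | y + h ∈ C}) (C := boundaryShell ‖h‖ C) (fun y hy => by
      by_cases hyC : y + h ∈ C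
      · exact Or.inl hyC
      · exact Or.inr ⟨⟨y, hy, by rw [dist_self]; exact norm_nonneg h⟩, _, hyC, hd y⟩)
  rw [abs_le]
  constructor <;> linarith

/-- Reduction of the distance to a nondegenerate Gaussian measure to the distance of a standardized
and centered law to the standard Gaussian measure. -/
theorem convexDist_map_stdGaussian_le {d : ℕ} (m : Measure (EuclideanSpace ℝ (Fin d)))
    [IsProbabilityMeasure m] {A S : EuclideanSpace ℝ (Fin d) →L[ℝ] EuclideanSpace ℝ (Fin d)}
    (hSA : ∀ x, S (A x) = x) (h : EuclideanSpace ℝ (Fin d)) :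
    convexDist m ((stdGaussian (EuclideanSpace ℝ (Fin d))).map S) ≤
      convexDist (m.map fun x => A x + -h) (stdGaussian (EuclideanSpace ℝ (Fin d))) +
        4 * (d * √d) * ‖h‖ := by
  refine convexDist_le fun C hC hCm => ?_
  have hmeas : Measurable fun x => A x + -h := by fun_prop
  have hp : IsProbabilityMeasure (m.map fun x => A x + -h) :=
    Measure.isProbabilityMeasure_map hmeas.aemeasurable
  set C₂ := S ⁻¹' C with hC₂
  have hC₂c : Convex ℝ C₂ := hC.linear_preimage S.toLinearMap
  have hC₂m : MeasurableSet C₂ := hCm.preimage S.continuous.measurable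
  set C₁ := {y | y + h ∈ C₂} with hC₁
  have hC₁c : Convex ℝ C₁ := hC₂c.translate_preimage_left h
  have hC₁m : MeasurableSet C₁ := hC₂m.preimage (f := fun y => y + h) (by fun_prop)
  have h1 : (m.map fun x => A x + -h).real C₁ = m.real C := by
    rw [map_measureReal_apply hmeas hC₁m]
    congr 1
    ext x
    simp [hC₁, hC₂, hSA]
  have h2 : ((stdGaussian (EuclideanSpace ℝ (Fin d))).map S).real C =
      (stdGaussian (EuclideanSpace ℝ (Fin d))).real C₂ :=
    map_measureReal_apply S.continuous.measurable hCm
  have h3 := le_convexDist (m.map fun x => A x + -h) (stdGaussian (EuclideanSpace ℝ (Fin d)))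
    hC₁c hC₁m
  have h4 := abs_stdGaussian_translate_sub_le hC₂c h
  rw [h1] at h3
  rw [h2]
  exact (abs_sub_le _ _ _).trans (add_le_add h3 h4)

theorem exists_norm_iteratedFDeriv_le_on_closedBall {E F : Type*} [NormedAddCommGroup E]
    [NormedSpace ℝ E] [ProperSpace E] [NormedAddCommGroup F] [NormedSpace ℝ F] {f : E → F} {N : ℕ}
    (hf : ContDiff ℝ (N : ℕ∞) f) (R : ℝ) :
    ∃ C : ℝ, ∀ j ≤ N, ∀ x, ‖x‖ ≤ R → ‖iteratedFDeriv ℝ j f x‖ ≤ C := by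
  have h : ∀ j : ℕ, ∃ C : ℝ, j ≤ N → ∀ x, ‖x‖ ≤ R → ‖iteratedFDeriv ℝ j f x‖ ≤ C := by
    intro j
    by_cases hj : j ≤ N
    · obtain ⟨C, hC⟩ := (isCompact_closedBall (0 : E) R).exists_bound_of_continuousOn
        (hf.continuous_iteratedFDeriv (m := j) (by exact_mod_cast hj)).continuousOn
      exact ⟨C, fun _ x hx => hC x (by simpa using hx)⟩
    · exact ⟨0, fun h => absurd h hj⟩
  choose C hC using h
  refine ⟨∑ j ∈ Finset.range (N + 1), |C j|,
    fun j hj x hx => ((hC j hj x hx).trans (le_abs_self _)).trans ?_⟩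
  exact Finset.single_le_sum (f := fun j => |C j|) (fun _ _ => abs_nonneg _)
    (Finset.mem_range.2 (by omega))

theorem exists_norm_iteratedFDeriv_cexp_inner_le {E : Type*} [NormedAddCommGroup E]
    [InnerProductSpace ℝ E] (N : ℕ) (β R : ℝ) : ∃ C : ℝ, ∀ b : E, ‖b‖ ≤ β → ∀ j ≤ N, ∀ x,
      ‖x‖ ≤ R → ‖iteratedFDeriv ℝ j
        (fun ζ : E => Complex.exp (-((inner ℝ b ζ : ℝ) * Complex.I))) x‖ ≤ C := by
  have hsm : ContDiff ℝ (N : ℕ∞) fun r : ℝ => Complex.exp (-((r : ℂ) * Complex.I)) :=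
    (Complex.contDiff_exp (𝕜 := ℝ)).comp
      ((Complex.ofRealCLM.contDiff.mul contDiff_const).neg)
  obtain ⟨C, hC⟩ := exists_norm_iteratedFDeriv_le_on_closedBall hsm (β * R)
  refine ⟨|C| * (1 + |β|) ^ N, fun b hb j hj x hx => ?_⟩
  have hb' : ‖innerSL ℝ b‖ ≤ 1 + |β| := by
    rw [innerSL_apply_norm]
    linarith [le_abs_self β]
  have hin : ‖innerSL ℝ b x‖ ≤ β * R := by
    rw [innerSL_apply_apply]
    exact (norm_inner_le_norm _ _).trans
      (mul_le_mul hb hx (norm_nonneg _) ((norm_nonneg _).trans hb))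
  refine (norm_iteratedFDeriv_comp_clm_le (innerSL ℝ b) hsm x (by exact_mod_cast hj)).trans ?_
  have h1 : 1 ≤ 1 + |β| := le_add_of_nonneg_right (abs_nonneg β)
  refine mul_le_mul ((hC j hj _ hin).trans (le_abs_self _)) ?_ (by positivity) (abs_nonneg _)
  exact (pow_le_pow_left₀ (norm_nonneg _) hb' j).trans (pow_le_pow_right₀ h1 hj)

section SquareRoot

variable {d : ℕ} {K : Matrix (Fin d) (Fin d) ℝ}

theorem toEuclideanCLM_sqrt_apply_sqrt_inv (hK : K.PosDef) (x : EuclideanSpace ℝ (Fin d)) :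
    Matrix.toEuclideanCLM (𝕜 := ℝ) (CFC.sqrt K)
      (Matrix.toEuclideanCLM (𝕜 := ℝ) (CFC.sqrt K⁻¹) x) = x := by
  have hu : IsUnit (CFC.sqrt K) := (CFC.isUnit_sqrt_iff K hK.posSemidef.nonneg).2 hK.isUnit
  rw [← ContinuousLinearMap.comp_apply, ← ContinuousLinearMap.mul_def, ← map_mul,
    ← hK.posSemidef.inv_sqrt, Matrix.mul_nonsing_inv _ ((Matrix.isUnit_iff_isUnit_det _).1 hu),
    map_one]
  rfl

theorem inner_toEuclideanCLM_sqrt (M : Matrix (Fin d) (Fin d) ℝ)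
    (x y : EuclideanSpace ℝ (Fin d)) :
    inner ℝ (Matrix.toEuclideanCLM (𝕜 := ℝ) (CFC.sqrt M) x) y =
      inner ℝ x (Matrix.toEuclideanCLM (𝕜 := ℝ) (CFC.sqrt M) y) := by
  have h : IsSelfAdjoint (Matrix.toEuclideanCLM (𝕜 := ℝ) (CFC.sqrt M)) :=
    (CFC.sqrt_nonneg M).isSelfAdjoint.map _
  conv_lhs => rw [← h.adjoint_eq, ContinuousLinearMap.adjoint_inner_left]

theorem dotProduct_mulVec_sqrt_inv (hK : K.PosDef) (x : EuclideanSpace ℝ (Fin d)) :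
    (Matrix.toEuclideanCLM (𝕜 := ℝ) (CFC.sqrt K⁻¹) x).ofLp ⬝ᵥ
      K.mulVec (Matrix.toEuclideanCLM (𝕜 := ℝ) (CFC.sqrt K⁻¹) x).ofLp = ‖x‖ ^ 2 := by
  rw [← Matrix.inner_toEuclideanCLM]
  conv_lhs =>
    enter [3, 1]
    rw [← CFC.sqrt_mul_sqrt_self K hK.posSemidef.nonneg]
  rw [map_mul, ContinuousLinearMap.mul_def, ContinuousLinearMap.comp_apply,
    ← inner_toEuclideanCLM_sqrt, toEuclideanCLM_sqrt_apply_sqrt_inv hK, real_inner_self_eq_norm_sq]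

theorem matSpectralNorm_sqrt_inv_pos (hd : 1 ≤ d) (hK : K.PosDef) :
    0 < matSpectralNorm (CFC.sqrt K⁻¹) := by
  rw [matSpectralNorm, norm_pos_iff]
  intro h
  have h1 := toEuclideanCLM_sqrt_apply_sqrt_inv hK (EuclideanSpace.single ⟨0, hd⟩ 1)
  rw [h] at h1
  have h2 := congrArg (fun v : EuclideanSpace ℝ (Fin d) => v ⟨0, hd⟩) h1
  simp at h2

theorem one_le_conditionNumber (hd : 1 ≤ d) (hK : K.PosDef) : 1 ≤ conditionNumber K := by
  have : Nonempty (Fin d) := ⟨⟨0, hd⟩⟩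
  have h : K * K⁻¹ = 1 :=
    Matrix.mul_nonsing_inv _ ((Matrix.isUnit_iff_isUnit_det _).1 hK.isUnit)
  calc (1 : ℝ) = ‖Matrix.toEuclideanCLM (𝕜 := ℝ) (K * K⁻¹)‖ := by rw [h, map_one, norm_one]
    _ ≤ conditionNumber K := by
      rw [map_mul]
      exact norm_mul_le _ _

end SquareRoot

/-- The residue of the standardized and centered law `K^{-1/2} (X - b)`, where `b` is the residual
mean. -/
noncomputable def standardizedResidue {d : ℕ} (K : Matrix (Fin d) (Fin d) ℝ) (t : ℝ)
    (μ : Measure (EuclideanSpace ℝ (Fin d))) (ζ : EuclideanSpace ℝ (Fin d)) : ℂ :=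
  residue K t μ (Matrix.toEuclideanCLM (𝕜 := ℝ) (CFC.sqrt K⁻¹) ζ) *
    Complex.exp (-((inner ℝ (Matrix.toEuclideanCLM (𝕜 := ℝ) (CFC.sqrt K⁻¹)
      (residueMean K t μ)) ζ : ℝ) * Complex.I))

section StandardizedResidue

variable {d : ℕ} {K : Matrix (Fin d) (Fin d) ℝ} {t : ℝ}
  {μ : Measure (EuclideanSpace ℝ (Fin d))}

theorem contDiff_cexp_neg_inner_mul_I {E : Type*} [NormedAddCommGroup E] [InnerProductSpace ℝ E]
    (b : E) {n : WithTop ℕ∞} :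
    ContDiff ℝ n fun ζ : E => Complex.exp (-((inner ℝ b ζ : ℝ) * Complex.I)) :=
  (Complex.contDiff_exp (𝕜 := ℝ)).comp
    ((Complex.ofRealCLM.contDiff.comp (innerSL ℝ b).contDiff).mul contDiff_const).neg

theorem contDiff_standardizedResidue {n : WithTop ℕ∞} (h : ContDiff ℝ n (residue K t μ)) :
    ContDiff ℝ n (standardizedResidue K t μ) :=
  (h.comp (ContinuousLinearMap.contDiff _)).mul (contDiff_cexp_neg_inner_mul_I _)

theorem standardizedResidue_zero [IsProbabilityMeasure μ] : standardizedResidue K t μ 0 = 1 := by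
  simp [standardizedResidue, residue_zero]

/-- The residue contributes `i⟨b, Av⟩`, and the centring factor cancels it since `A` is
self-adjoint. -/
theorem fderiv_standardizedResidue_zero [IsProbabilityMeasure μ]
    (h : Differentiable ℝ (residue K t μ)) : fderiv ℝ (standardizedResidue K t μ) 0 = 0 := by
  set A := Matrix.toEuclideanCLM (𝕜 := ℝ) (CFC.sqrt K⁻¹) with hA
  set b := residueMean K t μ with hb
  have h1 : HasFDerivAt (fun ζ => residue K t μ (A ζ)) ((fderiv ℝ (residue K t μ) 0).comp A) 0 := by
    have h0 : HasFDerivAt (residue K t μ) (fderiv ℝ (residue K t μ) 0) (A 0) := by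
      rw [map_zero]
      exact (h 0).hasFDerivAt
    exact h0.comp 0 A.hasFDerivAt
  have h2 : HasFDerivAt (fun ζ => Complex.exp (-((inner ℝ (A b) ζ : ℝ) * Complex.I)))
      ((-Complex.I) • Complex.ofRealCLM.comp (innerSL ℝ (A b))) 0 := by
    have h3 : HasFDerivAt (fun ζ => -((inner ℝ (A b) ζ : ℝ) * Complex.I))
        ((-Complex.I) • Complex.ofRealCLM.comp (innerSL ℝ (A b))) 0 := by
      have := ((Complex.ofRealCLM.comp (innerSL ℝ (A b))).hasFDerivAt (x := 0)).const_smul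
        (-Complex.I)
      refine this.congr_of_eventuallyEq (Eventually.of_forall fun ζ => ?_)
      simp [mul_comm]
    have h4 := h3.cexp
    simpa using h4
  have h5 := h1.mul h2
  refine (h5.congr_fderiv ?_).fderiv
  ext v
  simp [fderiv_residue_zero h, residue_zero, ← hb, hA, inner_toEuclideanCLM_sqrt, mul_comm]

/-- At `Aξ/√t` the quadratic form of `K` becomes `‖ξ‖²/t`, so the exponential in the residue cancels
the Gaussian factor; the translation produces the centring phase. -/
theorem charFun_standardized_eq [IsProbabilityMeasure μ] (hK : K.PosDef) (ht : 0 < t)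
    (ξ : EuclideanSpace ℝ (Fin d)) :
    charFun ((μ.map fun x => (√t)⁻¹ • x).map fun x =>
        Matrix.toEuclideanCLM (𝕜 := ℝ) (CFC.sqrt K⁻¹) x +
          -((√t)⁻¹ • Matrix.toEuclideanCLM (𝕜 := ℝ) (CFC.sqrt K⁻¹) (residueMean K t μ))) ξ =
      standardizedResidue K t μ ((√t)⁻¹ • ξ) * (Real.exp (-(1 / 2 * ‖ξ‖ ^ 2)) : ℂ) := by
  set A := Matrix.toEuclideanCLM (𝕜 := ℝ) (CFC.sqrt K⁻¹) with hA
  set b := residueMean K t μ with hb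
  set m := μ.map fun x => (√t)⁻¹ • x with hm
  have h1 : (m.map fun x => A x + -((√t)⁻¹ • A b)) =
      (m.map A).map fun x => x + -((√t)⁻¹ • A b) :=
    (Measure.map_map (g := fun x => x + -((√t)⁻¹ • A b)) (by fun_prop) (by fun_prop)).symm
  have h2 : charFun (m.map A) ξ = charFun μ (A ((√t)⁻¹ • ξ)) := by
    rw [map_smul, ← charFun_map_smul, ← hm, charFun_apply, charFun_apply,
      integral_map (by fun_prop) (by fun_prop)]
    simp only [hA, inner_toEuclideanCLM_sqrt]
  have hst : √t ^ 2 = t := Real.sq_sqrt ht.le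
  have h3 : t * ((A ((√t)⁻¹ • ξ)).ofLp ⬝ᵥ K.mulVec (A ((√t)⁻¹ • ξ)).ofLp) / 2 =
      1 / 2 * ‖ξ‖ ^ 2 := by
    rw [hA, dotProduct_mulVec_sqrt_inv hK, norm_smul, mul_pow, norm_inv, inv_pow,
      Real.norm_of_nonneg (Real.sqrt_nonneg t), hst]
    field_simp
  have h4 : Complex.exp ((1 / 2 * ‖ξ‖ ^ 2 : ℝ) : ℂ) * (Real.exp (-(1 / 2 * ‖ξ‖ ^ 2)) : ℂ) = 1 := by
    rw [Complex.ofReal_exp, ← Complex.exp_add, ← Complex.ofReal_add, add_neg_cancel,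
      Complex.ofReal_zero, Complex.exp_zero]
  rw [h1, charFun_map_add_const, h2, standardizedResidue, ← hA, ← hb, residue, h3,
    real_inner_smul_right, inner_neg_left, real_inner_smul_left, Complex.ofReal_neg, neg_mul]
  set e := Complex.exp (-(((√t)⁻¹ * inner ℝ (A b) ξ : ℝ) * Complex.I))
  linear_combination -(charFun μ (A ((√t)⁻¹ • ξ)) * e) * h4

end StandardizedResidue

/-! ### Final estimate and comparison of constants. -/

theorem StrongModGaussian.eventually_convexDist_le {d : ℕ} (hd : 1 ≤ d)
    {K : Matrix (Fin d) (Fin d) ℝ} (hK : K.PosDef) {t : ℕ → ℝ}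
    {μ : ℕ → Measure (EuclideanSpace ℝ (Fin d))} [∀ n, IsProbabilityMeasure (μ n)]
    {θ : EuclideanSpace ℝ (Fin d) → ℂ} (h : StrongModGaussian K t μ θ) {B η : ℝ} (hB : 0 ≤ B)
    (hη : 0 < η) :
    ∀ᶠ n in atTop, convexDist ((μ n).map fun x => (√(t n))⁻¹ • x) (multivariateGaussian 0 K) ≤
      (η + 4 * d ^ 2 * matSpectralNorm (CFC.sqrt K⁻¹) * (residueSup K t μ B).toReal) *
        (1 / √(t n)) := by
  set A := Matrix.toEuclideanCLM (𝕜 := ℝ) (CFC.sqrt K⁻¹) with hA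
  set M := (residueSup K t μ B).toReal with hM
  have hM0 : 0 ≤ M := ENNReal.toReal_nonneg
  have hne : (((d + 1 : ℕ) : ℕ∞) : WithTop ℕ∞) ≠ 0 := by exact_mod_cast Nat.succ_ne_zero d
  set b := fun n => residueMean K (t n) (μ n) with hb
  have hbM : ∀ n, ‖b n‖ ≤ √d * M := fun n =>
    norm_residueMean_le (fun i => h.norm_partialDeriv_zero_le hB n (by omega) i) hM0
  have hAb : ∀ n, ‖A (b n)‖ ≤ ‖A‖ * (√d * M) := fun n =>
    (A.le_opNorm _).trans (mul_le_mul_of_nonneg_left (hbM n) (norm_nonneg _))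
  have hbd : ∀ R : ℝ, ∃ L : ℝ, ∀ n, ∀ j ≤ d + 1, ∀ x, ‖x‖ ≤ R →
      ‖iteratedFDeriv ℝ j (standardizedResidue K (t n) (μ n)) x‖ ≤ L := by
    intro R
    obtain ⟨L, hL⟩ := h.exists_norm_iteratedFDeriv_residue_le (‖A‖ * R)
    obtain ⟨C, hC⟩ := exists_norm_iteratedFDeriv_cexp_inner_le
      (E := EuclideanSpace ℝ (Fin d)) (d + 1) (‖A‖ * (√d * M)) R
    refine ⟨2 ^ (d + 1) * (|L| * (1 + ‖A‖) ^ (d + 1) * |C|), fun n j hj x hx => ?_⟩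
    have h1 : 1 ≤ 1 + ‖A‖ := le_add_of_nonneg_right (norm_nonneg A)
    have hAx : ‖A x‖ ≤ ‖A‖ * R :=
      (A.le_opNorm _).trans (mul_le_mul_of_nonneg_left hx (norm_nonneg _))
    refine (norm_iteratedFDeriv_mul_le_of_le (n := (d + 1 : ℕ))
      ((h.contDiff_residue n).comp A.contDiff)
      (contDiff_cexp_neg_inner_mul_I (A (b n))) (by exact_mod_cast hj)
      (a := |L| * (1 + ‖A‖) ^ (d + 1)) (b := |C|) (fun i hi => ?_)
      (fun i hi => (hC (A (b n)) (hAb n) i (hi.trans hj) x hx).trans (le_abs_self _))).trans ?_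
    · refine (norm_iteratedFDeriv_comp_clm_le A (h.contDiff_residue n) x
        (by exact_mod_cast hi.trans hj)).trans ?_
      refine mul_le_mul ((hL n i (hi.trans hj) _ hAx).trans (le_abs_self _)) ?_
        (by positivity) (abs_nonneg _)
      exact (pow_le_pow_left₀ (norm_nonneg _) (by linarith) i).trans
        (pow_le_pow_right₀ h1 (hi.trans hj))
    · refine mul_le_mul_of_nonneg_right ?_ (by positivity)
      exact pow_le_pow_right₀ one_le_two hj
  have hmeas : ∀ n, Measurable fun x : EuclideanSpace ℝ (Fin d) => (√(t n))⁻¹ • x :=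
    fun n => by fun_prop
  have hp : ∀ n, IsProbabilityMeasure ((μ n).map fun x => (√(t n))⁻¹ • x) :=
    fun n => Measure.isProbabilityMeasure_map (hmeas n).aemeasurable
  have hp' : ∀ n, IsProbabilityMeasure (((μ n).map fun x => (√(t n))⁻¹ • x).map fun x =>
      A x + -((√(t n))⁻¹ • A (b n))) :=
    fun n => Measure.isProbabilityMeasure_map (Measurable.aemeasurable (by fun_prop))
  have hcore := eventually_convexDist_stdGaussian_le hd
    (fun n => ((μ n).map fun x => (√(t n))⁻¹ • x).map fun x => A x + -((√(t n))⁻¹ • A (b n)))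
    h.tendsto_atTop (fun n => standardizedResidue K (t n) (μ n))
    (fun n => contDiff_standardizedResidue (h.contDiff_residue n))
    (fun n => standardizedResidue_zero)
    (fun n => fderiv_standardizedResidue_zero ((h.contDiff_residue n).differentiable hne))
    hbd (fun n hn ξ => charFun_standardized_eq hK hn ξ) hη
  filter_upwards [hcore] with n hn
  have hgauss : multivariateGaussian 0 K = (stdGaussian (EuclideanSpace ℝ (Fin d))).map
      (Matrix.toEuclideanCLM (𝕜 := ℝ) (CFC.sqrt K)) := by
    simp only [multivariateGaussian, zero_add]
  rw [hgauss]
  refine (convexDist_map_stdGaussian_le _ (toEuclideanCLM_sqrt_apply_sqrt_inv hK)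
    ((√(t n))⁻¹ • A (b n))).trans ((add_le_add hn le_rfl).trans ?_)
  rw [norm_smul, Real.norm_of_nonneg (by positivity), add_mul, mul_one_div]
  refine add_le_add le_rfl ?_
  have hdd : √(d : ℝ) * √d = d := Real.mul_self_sqrt (Nat.cast_nonneg d)
  calc 4 * (d * √d) * ((√(t n))⁻¹ * ‖A (b n)‖)
      ≤ 4 * (d * √d) * ((√(t n))⁻¹ * (‖A‖ * (√d * M))) := by gcongr; exact hAb n
    _ = 4 * (d * (√d * √d)) * ‖A‖ * M * (1 / √(t n)) := by ring
    _ = 4 * d ^ 2 * matSpectralNorm (CFC.sqrt K⁻¹) * M * (1 / √(t n)) := by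
      rw [hdd, matSpectralNorm, ← hA, sq]

/-- The factors `2π/e`, `τ(K)` and `1/(1 - 4/(9π))` are at least `1` and the `1/B` term is
nonnegative. It then suffices that `1 + 4d² ≤ 2(d+1)⁴`, the exponent `3d/2 + 13/4` exceeding `4` for
`d ≥ 2`. -/
theorem le_berryEsseenConst {d : ℕ} (hd : 2 ≤ d) {K : Matrix (Fin d) (Fin d) ℝ} (hK : K.PosDef)
    {M B : ℝ} (hM : 1 ≤ M) (hB : 0 < B) :
    matSpectralNorm (CFC.sqrt K⁻¹) + 4 * d ^ 2 * matSpectralNorm (CFC.sqrt K⁻¹) * M ≤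
      berryEsseenConst K M B := by
  set ρ := matSpectralNorm (CFC.sqrt K⁻¹) with hρ
  have hρ0 : 0 < ρ := matSpectralNorm_sqrt_inv_pos (by omega) hK
  have hτ : 1 ≤ conditionNumber K := one_le_conditionNumber (by omega) hK
  have hd1 : (1 : ℝ) ≤ (d : ℝ) + 1 := by linarith [(Nat.cast_nonneg d : (0 : ℝ) ≤ d)]
  have hd2 : (2 : ℝ) ≤ d := by exact_mod_cast hd
  have hπ := Real.pi_gt_three
  have hden0 : 0 < 1 - 4 / (9 * Real.pi) := by
    rw [sub_pos, div_lt_one (by positivity)]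
    linarith
  have hden1 : 1 - 4 / (9 * Real.pi) ≤ 1 := sub_le_self _ (by positivity)
  have h1 : 2 * ρ ≤ 2 * ρ / (1 - 4 / (9 * Real.pi)) := by
    rw [le_div_iff₀ hden0]
    exact mul_le_of_le_one_right (by positivity) hden1
  have h2 : 1 ≤ (2 * Real.pi / Real.exp 1) ^ ((d : ℝ) / 2) := by
    refine Real.one_le_rpow ?_ (by positivity)
    rw [one_le_div (Real.exp_pos 1)]
    linarith [Real.exp_one_lt_d9]
  have h3 : ((d : ℝ) + 1) ^ 4 ≤ ((d : ℝ) + 1) ^ (3 * (d : ℝ) / 2 + 13 / 4 : ℝ) := by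
    rw [← Real.rpow_natCast]
    refine Real.rpow_le_rpow_of_exponent_le hd1 ?_
    push_cast
    linarith
  have h4 : 1 ≤ conditionNumber K ^ ((d : ℝ) / 2 + 1) := Real.one_le_rpow hτ (by positivity)
  have h5 : ((d : ℝ) + 1) ^ 4 * M ≤ (2 * Real.pi / Real.exp 1) ^ ((d : ℝ) / 2) *
      ((d : ℝ) + 1) ^ (3 * (d : ℝ) / 2 + 13 / 4 : ℝ) * conditionNumber K ^ ((d : ℝ) / 2 + 1) *
        M := by
    refine mul_le_mul_of_nonneg_right ?_ (by linarith)
    exact (h3.trans (le_mul_of_one_le_left (by positivity) h2)).trans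
      (le_mul_of_one_le_right (by positivity) h4)
  have h6 : 0 ≤ 2 * √(((d : ℝ) + 1) * conditionNumber K) * (1 / B) := by positivity
  have h7 : 1 + 4 * (d : ℝ) ^ 2 * M ≤ 2 * (((d : ℝ) + 1) ^ 4 * M) := by
    have h8 : 1 + 4 * (d : ℝ) ^ 2 ≤ 2 * ((d : ℝ) + 1) ^ 4 := by nlinarith [sq_nonneg ((d : ℝ) + 1)]
    calc 1 + 4 * (d : ℝ) ^ 2 * M ≤ (1 + 4 * (d : ℝ) ^ 2) * M := by linarith
      _ ≤ 2 * ((d : ℝ) + 1) ^ 4 * M := mul_le_mul_of_nonneg_right h8 (by linarith)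
      _ = _ := by ring
  calc ρ + 4 * d ^ 2 * ρ * M = ρ * (1 + 4 * (d : ℝ) ^ 2 * M) := by ring
    _ ≤ ρ * (2 * (((d : ℝ) + 1) ^ 4 * M)) := by gcongr
    _ = 2 * ρ * (((d : ℝ) + 1) ^ 4 * M) := by ring
    _ ≤ berryEsseenConst K M B := by
      rw [berryEsseenConst, ← hρ]
      refine mul_le_mul h1 (h5.trans (le_add_of_nonneg_right h6)) (by positivity) (by positivity)

theorem theorem2 {d : ℕ} (hd : 1 ≤ d)
    {Ω : ℕ → Type*} [∀ n, MeasurableSpace (Ω n)]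
    (P : ∀ n, Measure (Ω n)) [∀ n, IsProbabilityMeasure (P n)]
    (X : ∀ n, Ω n → EuclideanSpace ℝ (Fin d)) (hX : ∀ n, AEMeasurable (X n) (P n))
    (K : Matrix (Fin d) (Fin d) ℝ) (hK : K.PosDef)
    (t : ℕ → ℝ) (θ : EuclideanSpace ℝ (Fin d) → ℂ)
    (h : StrongModGaussian K t (fun n => (P n).map (X n)) θ) :
    (fun n => convexDist ((P n).map (fun ω => (√(t n))⁻¹ • X n ω)) (multivariateGaussian 0 K))
        =O[atTop] (fun n => 1 / √(t n)) ∧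
    (2 ≤ d → ∀ B : ℝ, 0 < B →
      residueSup K t (fun n => (P n).map (X n)) B ≠ ⊤ ∧
      ∀ᶠ n in atTop,
        convexDist ((P n).map (fun ω => (√(t n))⁻¹ • X n ω)) (multivariateGaussian 0 K) ≤
          berryEsseenConst K (residueSup K t (fun n => (P n).map (X n)) B).toReal B *
            (1 / √(t n))) := by
  have hp : ∀ n, IsProbabilityMeasure ((P n).map (X n)) :=
    fun n => Measure.isProbabilityMeasure_map (hX n)
  have hmap : ∀ n, (P n).map (fun ω => (√(t n))⁻¹ • X n ω) =
      ((P n).map (X n)).map fun x => (√(t n))⁻¹ • x := fun n => by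
    rw [AEMeasurable.map_map_of_aemeasurable (by fun_prop) (hX n)]
    rfl
  simp only [hmap]
  have hρ := matSpectralNorm_sqrt_inv_pos hd hK
  constructor
  · refine IsBigO.of_bound (matSpectralNorm (CFC.sqrt K⁻¹) + 4 * d ^ 2 *
      matSpectralNorm (CFC.sqrt K⁻¹) * (residueSup K t (fun n => (P n).map (X n)) 1).toReal) ?_
    filter_upwards [h.eventually_convexDist_le hd hK zero_le_one hρ] with n hn
    rwa [Real.norm_of_nonneg (convexDist_nonneg _ _), Real.norm_of_nonneg (by positivity)]
  · intro hd2 B hB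
    refine ⟨h.residueSup_ne_top B, ?_⟩
    -- The derivative of order zero at the origin is `θₙ(0) = 1`.
    have hM : 1 ≤ (residueSup K t (fun n => (P n).map (X n)) B).toReal := by
      have := h.norm_partialDeriv_zero_le hB.le 0 (Nat.zero_le _) (Fin.elim0 : Fin 0 → Fin d)
      rwa [partialDeriv, iteratedFDeriv_zero_apply, residue_zero, norm_one] at this
    filter_upwards [h.eventually_convexDist_le hd hK hB.le hρ] with n hn
    exact hn.trans (mul_le_mul_of_nonneg_right (le_berryEsseenConst hd2 hK hM hB) (by positivity))
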